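/- Let $K\subseteq\mathbb R^2$ be a convex set with non-empty interior. A *cut* of $K$ is a line that meets the interior of $K$. The *pieces* produced by cuts $c_1,\dots,c_a$ ($a\ge 0$) are the connected components of $K\setminus(c_1\cup\dots\cup c_a)$; $N_{\mathrm{pieces}}$ is their number and $N_{\mathrm{intersect}}$ is the number of pairs $i<j$ such that $c_i$ and $c_j$ meet in the interior of $K$. The cuts are *in general position* if they are pairwise distinct and no three of them meet in a common point of the interior of $K$. 1. The number of pieces is always finite. If $c_1,\dots,c_a$ are in general position, then $N_{\mathrm{intersect}}$ is also the number of points of the interior of $K$ that lie on at least two cuts, and $$N_{\mathrm{pieces}}=N_{\mathrm{intersect}}+a+1 .$$ 2. For every $a\ge 0$, the maximum of $N_{\mathrm{pieces}}$ over all choices of $a$ cuts of $K$ exists, equals the lazy caterer number $$\max N_{\mathrm{pieces}}=\binom a2+a+1=\frac{a^2}{2}+\frac a2+1 ,$$ and is attained by cuts in general position. 3. Let $K$ be the closed unit disc and let $c_i$ be the line through $(\cos\phi_{i,1},\sin\phi_{i,1})$ and $(\cos\phi_{i,2},\sin\phi_{i,2})$, where the $2a$ angles $\phi_{i,k}$ are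 independent and uniformly distributed on $(0,2\pi)$. Then $N_{\mathrm{intersect}}$ and $N_{\mathrm{pieces}}$ are integrable, $E[N_{\mathrm{intersect}}]=\frac{a(a-1)}{6}$, and $$E[N_{\mathrm{pieces}}]=E[N_{\mathrm{intersect}}]+a+1=\frac{a^2}{6}+\frac{5a}{6}+1 .$$ 4. For the unit disc with the random cuts of part 3, $$\lim_{a\to\infty}\frac{E[N_{\mathrm{pieces}}]}{\max N_{\mathrm{pieces}}}=\frac13 .$$ -/

import Mathlib

open MeasureTheory Filter Topology

namespace CrossingCuts

/-- The Euclidean plane. -/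
abbrev Plane : Type := EuclideanSpace ℝ (Fin 2)

/-- A straight cut of the region `K`: a line that passes through the interior of `K`.
(The corresponding chord is `K ∩ L`; removing the chord or the line from `K` is the same.) -/
def IsCut (K : Set Plane) (L : AffineSubspace ℝ Plane) : Prop :=
  Module.finrank ℝ L.direction = 1 ∧ (interior K ∩ (L : Set Plane)).Nonempty

/-- Cuts in general position in `K`: they are pairwise distinct, and no three of them
meet in a common point of the interior of `K`. -/
def GeneralPosition (K : Set Plane) {a : ℕ} (L : Fin a → AffineSubspace ℝ Plane) : Prop :=
  Function.Injective L ∧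
    ∀ i j k : Fin a, i ≠ j → j ≠ k → i ≠ k →
      ∀ p ∈ interior K, ¬ (p ∈ L i ∧ p ∈ L j ∧ p ∈ L k)

/-- What remains of `K` when all cuts have been removed. -/
def uncut (K : Set Plane) {a : ℕ} (L : Fin a → AffineSubspace ℝ Plane) : Set Plane :=
  K \ ⋃ i, (L i : Set Plane)

/-- The pieces: the connected components of `K` minus the cuts. -/
def pieces (K : Set Plane) {a : ℕ} (L : Fin a → AffineSubspace ℝ Plane) : Set (Set Plane) :=
  {P | ∃ x ∈ uncut K L, P = connectedComponentIn (uncut K L) x}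

/-- The number of pieces. -/
noncomputable def numPieces (K : Set Plane) {a : ℕ} (L : Fin a → AffineSubspace ℝ Plane) : ℕ :=
  (pieces K L).ncard

/-- The points inside `K` in which at least two of the cuts meet. -/
def crossingPoints (K : Set Plane) {a : ℕ} (L : Fin a → AffineSubspace ℝ Plane) : Set Plane :=
  {p | p ∈ interior K ∧ ∃ i j : Fin a, i ≠ j ∧ p ∈ L i ∧ p ∈ L j}

/-- The number of unordered pairs of cuts that intersect inside `K`. -/
noncomputable def numIntersect (K : Set Plane) {a : ℕ}
    (L : Fin a → AffineSubspace ℝ Plane) : ℕ :=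
  {q : Fin a × Fin a | q.1 < q.2 ∧
    (interior K ∩ ((L q.1 : Set Plane) ∩ (L q.2 : Set Plane))).Nonempty}.ncard

/-- All numbers of pieces that can be obtained by `a` cuts of `K`. -/
def pieceCounts (K : Set Plane) (a : ℕ) : Set ℕ :=
  {n | ∃ L : Fin a → AffineSubspace ℝ Plane, (∀ i, IsCut K (L i)) ∧ numPieces K L = n}

/-- The maximum number of pieces that can be obtained by `a` cuts of `K`. -/
noncomputable def maxPieces (K : Set Plane) (a : ℕ) : ℕ :=
  sSup (pieceCounts K a)

/-- The closed unit disc. -/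
def disc : Set Plane := Metric.closedBall 0 1

/-- The point of the unit circle at angle `t`. -/
noncomputable def circlePoint (t : ℝ) : Plane := !₂[Real.cos t, Real.sin t]

/-- The lines through the points of the unit circle at the angles `φ i 0` and `φ i 1`. -/
noncomputable def circleCuts {a : ℕ} (φ : Fin a → Fin 2 → ℝ) (i : Fin a) :
    AffineSubspace ℝ Plane :=
  line[ℝ, circlePoint (φ i 0), circlePoint (φ i 1)]

/-- The uniform distribution on `(0, 2π)`. -/
noncomputable def uniformAngle : Measure ℝ :=
  ProbabilityTheory.cond volume (Set.Ioo 0 (2 * Real.pi))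

/-- The joint law of the end-point angles of `a` random cuts of the unit circle:
`2a` independent uniform angles. -/
noncomputable def angleLaw (a : ℕ) : Measure (Fin a → Fin 2 → ℝ) :=
  Measure.pi fun _ => Measure.pi fun _ => uniformAngle

/-- The expected number of pieces of the disc for `a` random unit-circle cuts. -/
noncomputable def expectedPieces (a : ℕ) : ℝ :=
  ∫ φ, (numPieces disc (circleCuts φ) : ℝ) ∂(angleLaw a)

/-- The expected number of intersections of `a` random unit-circle cuts. -/
noncomputable def expectedIntersect (a : ℕ) : ℝ :=
  ∫ φ, (numIntersect disc (circleCuts φ) : ℝ) ∂(angleLaw a)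

end CrossingCuts

/-! Each cut is the zero set of a nonzero affine functional. A piece is then the set of points of
`K` outside the cuts with one fixed sign pattern: a functional without zeros keeps its sign on a
connected set, and a set with prescribed signs is convex. Counting pieces thus becomes counting the
sign patterns realised in the interior of `K` (`numPieces_eq_ncard_regions`).

Patterns obey deletion and restriction (`ncard_regions_insert`): a new line splits exactly those
patterns that it meets, so it adds as many patterns as the earlier functionals cut out on the line
itself. On a line the same recursion counts one more than the number of distinct crossing points. In
general position each crossing pair therefore contributes one piece and each cut one more, beyond
the initial piece. Without that assumption the recursion still gives the upper bound, and tangents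
of a small parabola attain it.

For random chords, almost every choice of angles gives cuts in general position: with two chords and
one end of a third fixed, only countably many other ends make the third pass through the interior
crossing point. Two chords meet inside the disc exactly when their end points are interlaced. Of the
three ways to pair four distinct angles exactly one is interlaced, and the pairings are
exchangeable, so the probability is 1/3 (`measure_interlaced`). Linearity of expectation over the
pairs of chords gives the means, and the ratio of leading coefficients gives the limit. -/

namespace CrossingCuts

/-! ### Sign patterns of affine functionals: deletion and restriction -/

section Regions

variable {E ι : Type*} [AddCommGroup E] [Module ℝ E]

/-- The indices in `s` whose functional is positive at `x`. -/
noncomputable def posSet (f : ι → E →ᵃ[ℝ] ℝ) (s : Finset ι) (x : E) : Finset ι :=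
  open Classical in s.filter fun i => 0 < f i x

/-- The sign patterns of the points of `U` at which no functional with index in `s` vanishes. -/
def regions (f : ι → E →ᵃ[ℝ] ℝ) (U : Set E) (s : Finset ι) : Set (Finset ι) :=
  {P | ∃ x ∈ U, (∀ i ∈ s, f i x ≠ 0) ∧ posSet f s x = P}

/-- A convex set that is open in its affine span, phrased without a topology on `E`. -/
def RelOpenConvex (U : Set E) : Prop :=
  Convex ℝ U ∧ ∀ x ∈ U, ∀ y ∈ U, ∀ᶠ t in 𝓝 (0 : ℝ), AffineMap.lineMap x y t ∈ U

variable {f : ι → E →ᵃ[ℝ] ℝ} {U : Set E} {s : Finset ι} {i : ι}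

theorem mem_posSet {x : E} : i ∈ posSet f s x ↔ i ∈ s ∧ 0 < f i x := by
  simp [posSet]

theorem posSet_eq_iff {x y : E} :
    posSet f s x = posSet f s y ↔ ∀ i ∈ s, (0 < f i x ↔ 0 < f i y) := by
  simp only [Finset.ext_iff, mem_posSet]
  grind

theorem affine_lineMap (g : E →ᵃ[ℝ] ℝ) (x y : E) (t : ℝ) :
    g (AffineMap.lineMap x y t) = (1 - t) * g x + t * g y := by
  rw [AffineMap.apply_lineMap, AffineMap.lineMap_apply_module]
  simp

theorem regions_subset_powerset : regions f U s ⊆ (s.powerset : Set (Finset ι)) := by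
  rintro P ⟨x, -, -, rfl⟩
  simp only [Finset.coe_powerset, Set.mem_preimage, Set.mem_powerset_iff, Finset.coe_subset]
  exact fun i hi => (mem_posSet.1 hi).1

theorem regions_finite : (regions f U s).Finite :=
  (Finset.finite_toSet _).subset regions_subset_powerset

theorem regions_mono {V : Set E} (h : U ⊆ V) : regions f U s ⊆ regions f V s := by
  rintro P ⟨x, hx, h1, h2⟩
  exact ⟨x, h hx, h1, h2⟩

theorem regions_eq_empty (hi : i ∈ s) (h : ∀ x ∈ U, f i x = 0) : regions f U s = ∅ := by
  ext P
  simp only [Set.mem_empty_iff_false, iff_false]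
  rintro ⟨x, hx, h1, -⟩
  exact h1 i hi (h x hx)

theorem ncard_regions_of_subsingleton (h : U.Subsingleton) : (regions f U s).ncard ≤ 1 := by
  rw [Set.ncard_le_one regions_finite]
  rintro P ⟨x, hx, -, rfl⟩ Q ⟨y, hy, -, rfl⟩
  rw [h hx hy]

theorem ncard_regions_of_nonempty_subsingleton (h : U.Subsingleton) (hne : U.Nonempty)
    (hz : ∀ x ∈ U, ∀ i ∈ s, f i x ≠ 0) : (regions f U s).ncard = 1 := by
  obtain ⟨x, hx⟩ := hne
  refine le_antisymm (ncard_regions_of_subsingleton h) ?_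
  exact (Set.ncard_pos regions_finite).2 ⟨_, x, hx, hz x hx, rfl⟩

theorem ncard_regions_empty (hne : U.Nonempty) : (regions f U ∅).ncard = 1 := by
  obtain ⟨x, hx⟩ := hne
  rw [Set.ncard_eq_one]
  refine ⟨∅, Set.eq_singleton_iff_unique_mem.2 ⟨⟨x, hx, by simp, by simp [posSet]⟩, ?_⟩⟩
  rintro P ⟨y, -, -, rfl⟩
  simp [posSet]

/-- This closure property is why openness is only demanded along segments of `U`: the recursion for
the plane can be applied again on a line. -/
theorem RelOpenConvex.inter_zero (hU : RelOpenConvex U) (g : E →ᵃ[ℝ] ℝ) :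
    RelOpenConvex (U ∩ {x | g x = 0}) := by
  refine ⟨hU.1.inter ?_, ?_⟩
  · exact (convex_singleton (𝕜 := ℝ) (0 : ℝ)).affine_preimage g
  · rintro x ⟨hx, hx0⟩ y ⟨hy, hy0⟩
    filter_upwards [hU.2 x hx y hy] with t ht
    refine ⟨ht, ?_⟩
    simp only [Set.mem_ofPred_eq] at *
    rw [affine_lineMap, hx0, hy0]; ring

theorem eventually_posSet_lineMap {x : E} (y : E) (h : ∀ i ∈ s, f i x ≠ 0) :
    ∀ᶠ t in 𝓝 (0 : ℝ), (∀ i ∈ s, f i (AffineMap.lineMap x y t) ≠ 0) ∧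
      posSet f s (AffineMap.lineMap x y t) = posSet f s x := by
  have key : ∀ᶠ t in 𝓝 (0 : ℝ), ∀ i ∈ s, f i (AffineMap.lineMap x y t) ≠ 0 ∧
      (0 < f i (AffineMap.lineMap x y t) ↔ 0 < f i x) := by
    rw [Filter.eventually_all_finset]
    intro i hi
    have hc : Tendsto (fun t : ℝ => f i (AffineMap.lineMap x y t)) (𝓝 0) (𝓝 (f i x)) := by
      have : Continuous fun t : ℝ => f i (AffineMap.lineMap x y t) := by
        simp only [affine_lineMap]; fun_prop
      simpa using this.tendsto 0
    rcases lt_or_gt_of_ne (h i hi) with h0 | h0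
    · filter_upwards [hc.eventually (gt_mem_nhds h0)] with t ht
      exact ⟨ht.ne, by constructor <;> intro <;> linarith⟩
    · filter_upwards [hc.eventually (lt_mem_nhds h0)] with t ht
      exact ⟨ht.ne', by constructor <;> intro <;> assumption⟩
  filter_upwards [key] with t ht
  exact ⟨fun i hi => (ht i hi).1, posSet_eq_iff.2 fun i hi => (ht i hi).2⟩

/-- From a zero of `g`, one can move inside `U` to both sides without changing the pattern. -/
theorem RelOpenConvex.exists_both_sides (hU : RelOpenConvex U) (g : E →ᵃ[ℝ] ℝ)
    (hg : ∃ y ∈ U, g y ≠ 0) {x : E} (hx : x ∈ U) (hx0 : g x = 0) (h : ∀ i ∈ s, f i x ≠ 0) :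
    posSet f s x ∈ regions f (U ∩ {x | 0 < g x}) s ∧
      posSet f s x ∈ regions f (U ∩ {x | g x < 0}) s := by
  obtain ⟨y, hy, hy0⟩ := hg
  have hev := (hU.2 x hx y hy).and (eventually_posSet_lineMap (f := f) (s := s) y h)
  obtain ⟨ε, hε, hball⟩ := Metric.eventually_nhds_iff.1 hev
  have hp := hball (y := ε / 2) (by rw [Real.dist_eq, sub_zero, abs_of_pos] <;> linarith)
  have hn := hball (y := -(ε / 2)) (by
    rw [Real.dist_eq, sub_zero, abs_neg, abs_of_pos] <;> linarith)
  have vp := affine_lineMap g x y (ε / 2)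
  have vn := affine_lineMap g x y (-(ε / 2))
  rw [hx0] at vp vn
  -- Along the line through `x` and `y`, `g` equals `t * g y`, so the sign of `g y` decides which of
  -- the parameters `±ε / 2` lands on which side.
  rcases lt_or_gt_of_ne hy0 with h0 | h0
  · refine ⟨⟨_, ⟨hn.1, ?_⟩, hn.2⟩, ⟨_, ⟨hp.1, ?_⟩, hp.2⟩⟩
    · simp only [Set.mem_ofPred_eq, vn]; nlinarith
    · simp only [Set.mem_ofPred_eq, vp]; nlinarith
  · refine ⟨⟨_, ⟨hp.1, ?_⟩, hp.2⟩, ⟨_, ⟨hn.1, ?_⟩, hn.2⟩⟩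
    · simp only [Set.mem_ofPred_eq, vp]; nlinarith
    · simp only [Set.mem_ofPred_eq, vn]; nlinarith

theorem regions_union_sides (hU : RelOpenConvex U) (g : E →ᵃ[ℝ] ℝ) (hg : ∃ y ∈ U, g y ≠ 0) :
    regions f (U ∩ {x | 0 < g x}) s ∪ regions f (U ∩ {x | g x < 0}) s = regions f U s := by
  refine Set.Subset.antisymm (Set.union_subset (regions_mono Set.inter_subset_left)
    (regions_mono Set.inter_subset_left)) ?_
  rintro P ⟨x, hx, h1, rfl⟩
  rcases lt_trichotomy (g x) 0 with h0 | h0 | h0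
  · exact Or.inr ⟨x, ⟨hx, h0⟩, h1, rfl⟩
  · exact Or.inl (hU.exists_both_sides g hg hx h0 h1).1
  · exact Or.inl ⟨x, ⟨hx, h0⟩, h1, rfl⟩

/-- If two points on opposite sides of `g` share a pattern, the whole segment between them has it,
and the segment crosses the zero set. Conversely, a zero of `g` can be pushed to both sides. -/
theorem regions_inter_sides (hU : RelOpenConvex U) (g : E →ᵃ[ℝ] ℝ) (hg : ∃ y ∈ U, g y ≠ 0) :
    regions f (U ∩ {x | 0 < g x}) s ∩ regions f (U ∩ {x | g x < 0}) s =
      regions f (U ∩ {x | g x = 0}) s := by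
  refine Set.Subset.antisymm ?_ ?_
  · rintro P ⟨⟨x, ⟨hx, hx0⟩, hxs, rfl⟩, ⟨y, ⟨hy, hy0⟩, hys, hxy⟩⟩
    rw [posSet_eq_iff] at hxy
    simp only [Set.mem_ofPred_eq] at hx0 hy0
    have hd : 0 < g x - g y := by linarith
    -- The parameter at which `g` vanishes on the segment from `x` to `y`.
    set t := g x / (g x - g y) with ht
    have ht0 : 0 < t := by positivity
    have ht1 : t < 1 := by rw [ht, div_lt_one hd]; linarith
    have hsign : ∀ j ∈ s, f j (AffineMap.lineMap x y t) ≠ 0 ∧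
        (0 < f j (AffineMap.lineMap x y t) ↔ 0 < f j x) := by
      intro j hj
      rw [affine_lineMap]
      rcases lt_or_gt_of_ne (hxs j hj) with h0 | h0
      · have : f j y < 0 := lt_of_le_of_ne
          (not_lt.1 fun h => by have := (hxy j hj).1 h; linarith) (hys j hj)
        have : (1 - t) * f j x + t * f j y < 0 := by nlinarith
        exact ⟨this.ne, by constructor <;> intro <;> linarith⟩
      · have := (hxy j hj).2 h0
        have : 0 < (1 - t) * f j x + t * f j y := by
          have := mul_pos ht0 this
          have := mul_pos (sub_pos.2 ht1) h0
          linarith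
        exact ⟨this.ne', by constructor <;> intro <;> assumption⟩
    refine ⟨AffineMap.lineMap x y t, ⟨hU.1.lineMap_mem hx hy ⟨ht0.le, ht1.le⟩, ?_⟩,
      fun j hj => (hsign j hj).1, posSet_eq_iff.2 fun j hj => (hsign j hj).2⟩
    simp only [Set.mem_ofPred_eq, affine_lineMap, ht]
    field_simp
    ring
  · rintro P ⟨x, ⟨hx, hx0⟩, h1, rfl⟩
    exact hU.exists_both_sides g hg hx hx0 h1

variable [DecidableEq ι]

theorem posSet_insert_of_pos {x : E} (h : 0 < f i x) :
    posSet f (insert i s) x = insert i (posSet f s x) := by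
  ext j
  simp only [mem_posSet, Finset.mem_insert]
  grind

theorem posSet_insert_of_neg {x : E} (h : f i x < 0) :
    posSet f (insert i s) x = posSet f s x := by
  ext j
  simp only [mem_posSet, Finset.mem_insert]
  grind

theorem regions_insert (i : ι) :
    regions f U (insert i s) = insert i '' regions f (U ∩ {x | 0 < f i x}) s ∪
      regions f (U ∩ {x | f i x < 0}) s := by
  ext P
  constructor
  · rintro ⟨x, hx, h1, rfl⟩
    have h2 : ∀ j ∈ s, f j x ≠ 0 := fun j hj => h1 j (Finset.mem_insert_of_mem hj)
    rcases lt_or_gt_of_ne (h1 i (Finset.mem_insert_self i s)) with h0 | h0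
    · exact Or.inr ⟨x, ⟨hx, h0⟩, h2, (posSet_insert_of_neg h0).symm⟩
    · exact Or.inl ⟨_, ⟨x, ⟨hx, h0⟩, h2, rfl⟩, (posSet_insert_of_pos h0).symm⟩
  · rintro (⟨_, ⟨x, ⟨hx, h0⟩, h2, rfl⟩, rfl⟩ | ⟨x, ⟨hx, h0⟩, h2, rfl⟩)
    · refine ⟨x, hx, ?_, posSet_insert_of_pos h0⟩
      exact Finset.forall_mem_insert .. |>.2 ⟨ne_of_gt h0, h2⟩
    · refine ⟨x, hx, ?_, posSet_insert_of_neg h0⟩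
      exact Finset.forall_mem_insert .. |>.2 ⟨ne_of_lt h0, h2⟩

/-- Deletion and restriction: a new hyperplane adds as many regions as it has itself. -/
theorem ncard_regions_insert (hU : RelOpenConvex U) (hi : i ∉ s) (hg : ∃ y ∈ U, f i y ≠ 0) :
    (regions f U (insert i s)).ncard =
      (regions f U s).ncard + (regions f (U ∩ {x | f i x = 0}) s).ncard := by
  have hnot : ∀ V : Set E, ∀ P ∈ regions f V s, i ∉ P := fun V P hP hiP =>
    hi (Finset.mem_powerset.1 (regions_subset_powerset hP) hiP)
  -- The patterns on the two sides are counted separately; by inclusion and exclusion their sum is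
  -- the union, all old patterns, plus the intersection, those on the zero set.
  rw [regions_insert, Set.ncard_union_eq ?_ (regions_finite.image _) regions_finite,
    Set.InjOn.ncard_image,
    ← regions_union_sides hU (f i) hg, ← regions_inter_sides hU (f i) hg,
    Set.ncard_union_add_ncard_inter _ _ regions_finite regions_finite]
  · intro P hP Q hQ h
    rw [← Finset.erase_insert (hnot _ P hP), ← Finset.erase_insert (hnot _ Q hQ), h]
  · rw [Set.disjoint_left]
    rintro _ ⟨P, -, rfl⟩ h
    exact hnot _ _ h (Finset.mem_insert_self i P)

/-- An upper bound for the number of regions on a line. -/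
theorem ncard_regions_line_le (hU : RelOpenConvex U)
    (h : ∀ i ∈ s, (U ∩ {x | f i x = 0}).Subsingleton ∨ ∀ x ∈ U, f i x = 0) :
    (regions f U s).ncard ≤ s.card + 1 := by
  induction s using Finset.induction_on with
  | empty =>
    rcases U.eq_empty_or_nonempty with rfl | hne
    · simp [regions]
    · simp [ncard_regions_empty hne]
  | insert i s hi ih =>
    by_cases hz : ∀ x ∈ U, f i x = 0
    · simp [regions_eq_empty (Finset.mem_insert_self i s) hz]
    have hs := (h i (Finset.mem_insert_self i s)).resolve_right hz
    push Not at hz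
    rw [ncard_regions_insert hU hi hz, Finset.card_insert_of_notMem hi]
    have := ih fun j hj => h j (Finset.mem_insert_of_mem hj)
    have := ncard_regions_of_subsingleton (f := f) (s := s) hs
    omega

/-- The number of regions on a line, if different functionals have different zeros. -/
theorem ncard_regions_line [DecidablePred fun i => (U ∩ {x | f i x = 0}).Nonempty]
    (hU : RelOpenConvex U) (hne : U.Nonempty)
    (h : ∀ i ∈ s, (U ∩ {x | f i x = 0}).Subsingleton) (hz : ∀ i ∈ s, ∃ x ∈ U, f i x ≠ 0)
    (hgp : ∀ i ∈ s, ∀ j ∈ s, i ≠ j → ∀ x ∈ U, f i x = 0 → f j x ≠ 0) :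
    (regions f U s).ncard = (s.filter fun i => (U ∩ {x | f i x = 0}).Nonempty).card + 1 := by
  induction s using Finset.induction_on with
  | empty => simp [ncard_regions_empty hne]
  | insert i s hi ih =>
    have hself := Finset.mem_insert_self i s
    rw [ncard_regions_insert hU hi (hz i hself),
      ih (fun j hj => h j (Finset.mem_insert_of_mem hj))
        (fun j hj => hz j (Finset.mem_insert_of_mem hj))
        (fun j hj k hk => hgp j (Finset.mem_insert_of_mem hj) k (Finset.mem_insert_of_mem hk)),
      Finset.filter_insert]
    split_ifs with hn
    · rw [ncard_regions_of_nonempty_subsingleton (h i hself) hn, Finset.card_insert_of_notMem]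
      · simp [hi]
      · rintro x ⟨hx, hx0⟩ j hj
        exact hgp i hself j (Finset.mem_insert_of_mem hj) (fun e => hi (e ▸ hj)) x hx hx0
    · rw [Set.not_nonempty_iff_eq_empty.1 hn]
      simp [regions]

/-- An upper bound for the number of regions in a plane. -/
theorem ncard_regions_plane_le (hU : RelOpenConvex U)
    (h : ∀ i ∈ s, ∀ j ∈ s, (U ∩ {x | f i x = 0} ∩ {x | f j x = 0}).Subsingleton ∨
      ∀ x ∈ U ∩ {x | f i x = 0}, f j x = 0) :
    (regions f U s).ncard ≤ s.card.choose 2 + s.card + 1 := by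
  induction s using Finset.induction_on with
  | empty =>
    rcases U.eq_empty_or_nonempty with rfl | hne
    · simp [regions]
    · simp [ncard_regions_empty hne]
  | insert i s hi ih =>
    by_cases hz : ∀ x ∈ U, f i x = 0
    · simp [regions_eq_empty (Finset.mem_insert_self i s) hz]
    push Not at hz
    rw [ncard_regions_insert hU hi hz, Finset.card_insert_of_notMem hi]
    have h1 := ih fun j hj k hk => h j (Finset.mem_insert_of_mem hj) k (Finset.mem_insert_of_mem hk)
    have h2 := ncard_regions_line_le (s := s) (hU.inter_zero (f i)) fun j hj =>
      h i (Finset.mem_insert_self i s) j (Finset.mem_insert_of_mem hj)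
    have h3 : (s.card + 1).choose 2 = s.card + s.card.choose 2 := by
      rw [Nat.choose_succ_succ' s.card 1, Nat.choose_one_right]
    omega

end Regions

/-- The number of regions of a line arrangement in general position in a plane. -/
theorem ncard_regions_plane {E ι : Type*} [AddCommGroup E] [Module ℝ E] [LinearOrder ι]
    {f : ι → E →ᵃ[ℝ] ℝ} {U : Set E} {s : Finset ι}
    [∀ i, DecidablePred fun j => (U ∩ {x | f i x = 0} ∩ {x | f j x = 0}).Nonempty]
    (hU : RelOpenConvex U) (hne : ∀ i ∈ s, (U ∩ {x | f i x = 0}).Nonempty)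
    (hneU : U.Nonempty)
    (h0 : ∀ i ∈ s, ∃ x ∈ U, f i x ≠ 0)
    (h : ∀ i ∈ s, ∀ j ∈ s, i ≠ j → (U ∩ {x | f i x = 0} ∩ {x | f j x = 0}).Subsingleton)
    (hz : ∀ i ∈ s, ∀ j ∈ s, i ≠ j → ∃ x ∈ U ∩ {x | f i x = 0}, f j x ≠ 0)
    (hgp : ∀ i ∈ s, ∀ j ∈ s, ∀ k ∈ s, i ≠ j → j ≠ k → i ≠ k → ∀ x ∈ U,
      f i x = 0 → f j x = 0 → f k x ≠ 0) :
    (regions f U s).ncard = (∑ i ∈ s, (s.filter fun j => j < i ∧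
      (U ∩ {x | f i x = 0} ∩ {x | f j x = 0}).Nonempty).card) + s.card + 1 := by
  -- Adding the largest index last makes its summand count all earlier lines that it meets, and
  -- leaves the other summands unchanged.
  induction s using Finset.induction_on_max with
  | empty => simp [ncard_regions_empty hneU]
  | insert i s hlt ih =>
    have hi : i ∉ s := fun hi => lt_irrefl _ (hlt i hi)
    have hself := Finset.mem_insert_self i s
    have hm : ∀ {j}, j ∈ s → j ∈ insert i s := Finset.mem_insert_of_mem
    have hij : ∀ {j}, j ∈ s → i ≠ j := fun hj => (hlt _ hj).ne'
    rw [ncard_regions_insert hU hi (h0 i hself),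
      ih (fun j hj => hne j (hm hj)) (fun j hj => h0 j (hm hj))
        (fun j hj k hk => h j (hm hj) k (hm hk)) (fun j hj k hk => hz j (hm hj) k (hm hk))
        (fun j hj k hk l hl => hgp j (hm hj) k (hm hk) l (hm hl)),
      ncard_regions_line (hU.inter_zero (f i)) (hne i hself)
        (fun j hj => h i hself j (hm hj) (hij hj)) (fun j hj => hz i hself j (hm hj) (hij hj))
        (fun j hj k hk hjk x hx => hgp i hself j (hm hj) k (hm hk) (hij hj) hjk (hij hk)
          x hx.1 hx.2),
      Finset.sum_insert hi, Finset.card_insert_of_notMem hi]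
    have e1 : ((insert i s).filter fun j => j < i ∧
        (U ∩ {x | f i x = 0} ∩ {x | f j x = 0}).Nonempty) =
        s.filter fun j => (U ∩ {x | f i x = 0} ∩ {x | f j x = 0}).Nonempty := by
      ext j
      simp only [Finset.mem_filter, Finset.mem_insert]
      grind
    have e2 : ∀ k ∈ s, ((insert i s).filter fun j => j < k ∧
        (U ∩ {x | f k x = 0} ∩ {x | f j x = 0}).Nonempty) =
        s.filter fun j => j < k ∧ (U ∩ {x | f k x = 0} ∩ {x | f j x = 0}).Nonempty := by
      intro k hk
      ext j
      simp only [Finset.mem_filter, Finset.mem_insert]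
      have := hlt k hk
      grind
    rw [e1, Finset.sum_congr rfl fun k hk => congrArg Finset.card (e2 k hk)]
    omega

/-! ### Lines in the plane as zero sets -/

/-- The direction lies in the kernel of a nonzero linear functional and equals it by dimension;
subtracting the value at `p` gives the affine functional. -/
theorem exists_functional_of_line {L : AffineSubspace ℝ Plane}
    (h : Module.finrank ℝ L.direction = 1) {p : Plane} (hp : p ∈ L) :
    ∃ g : Plane →ᵃ[ℝ] ℝ, (∃ x, g x ≠ 0) ∧ ∀ x, x ∈ L ↔ g x = 0 := by
  have hlt : L.direction < ⊤ := by
    refine lt_top_iff_ne_top.2 fun e => ?_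
    rw [e, finrank_top, finrank_euclideanSpace_fin] at h
    omega
  obtain ⟨φ, hφ, hle⟩ := Submodule.exists_le_ker_of_lt_top _ hlt
  have hk : Module.finrank ℝ (LinearMap.ker φ) = 1 := by
    have h1 := φ.finrank_range_add_finrank_ker
    rw [LinearMap.range_eq_top.2 (LinearMap.surjective hφ), finrank_top,
      finrank_euclideanSpace_fin, Module.finrank_self] at h1
    omega
  have heq : L.direction = LinearMap.ker φ := Submodule.eq_of_le_of_finrank_eq hle (by rw [h, hk])
  refine ⟨φ.toAffineMap - AffineMap.const ℝ Plane (φ p), ?_, fun x => ?_⟩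
  · obtain ⟨v, hv⟩ : ∃ v, φ v ≠ 0 := by
      by_contra! hc
      exact hφ (LinearMap.ext hc)
    exact ⟨v + p, by simpa using hv⟩
  · have : x ∈ L ↔ x -ᵥ p ∈ L.direction :=
      (AffineSubspace.vsub_right_mem_direction_iff_mem hp x).symm
    rw [this, heq]
    simp

theorem line_inter_subsingleton {L M : AffineSubspace ℝ Plane}
    (hL : Module.finrank ℝ L.direction = 1) (hM : Module.finrank ℝ M.direction = 1)
    (hne : L ≠ M) {x y : Plane} (hxL : x ∈ L) (hxM : x ∈ M) (hyL : y ∈ L) (hyM : y ∈ M) :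
    x = y := by
  by_contra hxy
  have key : ∀ {N : AffineSubspace ℝ Plane}, Module.finrank ℝ N.direction = 1 → x ∈ N → y ∈ N →
      N.direction = ℝ ∙ (y -ᵥ x) := by
    intro N hN hx hy
    refine (Submodule.eq_of_le_of_finrank_eq ?_ ?_).symm
    · rw [Submodule.span_singleton_le_iff_mem]
      exact AffineSubspace.vsub_mem_direction hy hx
    · rw [hN, finrank_span_singleton]
      exact vsub_ne_zero.2 (Ne.symm hxy)
  exact hne (AffineSubspace.ext_of_direction_eq ((key hL hxL hyL).trans (key hM hxM hyM).symm)
    ⟨x, hxL, hxM⟩)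

theorem relOpenConvex_interior {K : Set Plane} (hK : Convex ℝ K) :
    RelOpenConvex (interior K) := by
  refine ⟨hK.interior, fun x hx y _ => ?_⟩
  have hc : Continuous fun t : ℝ => AffineMap.lineMap x y t := AffineMap.lineMap_continuous
  exact hc.tendsto' 0 x (by simp) (isOpen_interior.mem_nhds hx)

theorem exists_ne_zero_of_isOpen {U : Set Plane} (hU : IsOpen U) (hne : U.Nonempty)
    {g : Plane →ᵃ[ℝ] ℝ} (hg : ∃ x, g x ≠ 0) : ∃ x ∈ U, g x ≠ 0 := by
  obtain ⟨x, hx⟩ := hne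
  obtain ⟨y, hy⟩ := hg
  by_cases h0 : g x = 0
  · have hc : Continuous fun t : ℝ => AffineMap.lineMap x y t := AffineMap.lineMap_continuous
    have hev : ∀ᶠ t in 𝓝 (0 : ℝ), AffineMap.lineMap x y t ∈ U :=
      hc.tendsto' 0 x (by simp) (hU.mem_nhds hx)
    obtain ⟨t, ht, ht0⟩ := ((hev.filter_mono nhdsWithin_le_nhds).and
      (self_mem_nhdsWithin : Set.Ioi (0 : ℝ) ∈ 𝓝[>] 0)).exists
    refine ⟨_, ht, ?_⟩
    rw [affine_lineMap, h0]
    simpa using ⟨ne_of_gt ht0, hy⟩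
  · exact ⟨x, hx, h0⟩

theorem exists_ne_mem_line {U : Set Plane} (hU : IsOpen U) {L : AffineSubspace ℝ Plane}
    (hL : Module.finrank ℝ L.direction = 1) {x : Plane} (hx : x ∈ U) (hxL : x ∈ L) :
    ∃ y ∈ U, y ∈ L ∧ y ≠ x := by
  obtain ⟨v, hv, hv0⟩ := L.direction.ne_bot_iff.1 (fun e => by
    rw [e, finrank_bot] at hL; omega)
  have hc : Continuous fun t : ℝ => t • v + x := by fun_prop
  have hev : ∀ᶠ t in 𝓝 (0 : ℝ), t • v + x ∈ U := hc.tendsto' 0 x (by simp) (hU.mem_nhds hx)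
  obtain ⟨t, ht, ht0⟩ := ((hev.filter_mono nhdsWithin_le_nhds).and
    (self_mem_nhdsWithin : Set.Ioi (0 : ℝ) ∈ 𝓝[>] 0)).exists
  refine ⟨_, ht, AffineSubspace.vadd_mem_of_mem_direction (L.direction.smul_mem t hv) hxL, ?_⟩
  simpa using ⟨ne_of_gt ht0, hv0⟩

/-! ### Pieces and crossings of a convex region -/

section Pieces

variable {K : Set Plane} {a : ℕ} {L : Fin a → AffineSubspace ℝ Plane}
  {f : Fin a → Plane →ᵃ[ℝ] ℝ}

theorem exists_functionals (hL : ∀ i, IsCut K (L i)) :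
    ∃ f : Fin a → Plane →ᵃ[ℝ] ℝ, (∀ i, ∃ x, f i x ≠ 0) ∧ ∀ i x, x ∈ L i ↔ f i x = 0 := by
  choose f h1 h2 using fun i => exists_functional_of_line (hL i).1 (hL i).2.some_mem.2
  exact ⟨f, h1, h2⟩

theorem mem_uncut_iff (hf : ∀ i x, x ∈ L i ↔ f i x = 0) {x : Plane} :
    x ∈ uncut K L ↔ x ∈ K ∧ ∀ i ∈ Finset.univ, f i x ≠ 0 := by
  simp [uncut, hf]

/-- A sign change inside a component would force a zero by the intermediate value theorem.
Conversely, a sign class is convex, hence connected. -/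
theorem connectedComponentIn_uncut (hK : Convex ℝ K) (hf : ∀ i x, x ∈ L i ↔ f i x = 0)
    {x : Plane} (hx : x ∈ uncut K L) :
    connectedComponentIn (uncut K L) x =
      {y ∈ uncut K L | posSet f Finset.univ y = posSet f Finset.univ x} := by
  refine Set.Subset.antisymm ?_ ?_
  · intro y hy
    have hsub := connectedComponentIn_subset (uncut K L) x
    refine ⟨hsub hy, ?_⟩
    rw [posSet_eq_iff]
    intro i _
    have hpre : IsPreconnected (connectedComponentIn (uncut K L) x) :=
      isPreconnected_connectedComponentIn
    have hxm := mem_connectedComponentIn hx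
    have hcont : ContinuousOn (f i) (connectedComponentIn (uncut K L) x) :=
      (AffineMap.continuous_of_finiteDimensional (f i)).continuousOn
    have hno : ∀ z ∈ connectedComponentIn (uncut K L) x, f i z ≠ 0 := fun z hz =>
      ((mem_uncut_iff hf).1 (hsub hz)).2 i (Finset.mem_univ i)
    by_contra hc
    have h1 := hno x hxm
    have h2 := hno y hy
    have : (0 : ℝ) ∈ f i '' connectedComponentIn (uncut K L) x := by
      rcases lt_or_gt_of_ne h1 with h1 | h1 <;> rcases lt_or_gt_of_ne h2 with h2 | h2
      · exact absurd (by constructor <;> intro <;> linarith) hc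
      · exact hpre.intermediate_value hxm hy hcont ⟨h1.le, h2.le⟩
      · exact hpre.intermediate_value hy hxm hcont ⟨h2.le, h1.le⟩
      · exact absurd (by constructor <;> intro <;> assumption) hc
    obtain ⟨z, hz, hz0⟩ := this
    exact hno z hz hz0
  · refine IsPreconnected.subset_connectedComponentIn ?_ ⟨hx, rfl⟩ (Set.sep_subset _ _)
    refine Convex.isPreconnected ?_
    rw [convex_iff_forall_pos]
    rintro y ⟨hy, hyx⟩ z ⟨hz, hzx⟩ b c hb hc hbc
    rw [mem_uncut_iff hf] at hy hz
    rw [posSet_eq_iff] at hyx hzx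
    have hval : ∀ i, f i (b • y + c • z) = b * f i y + c * f i z := fun i => by
      have := affine_lineMap (f i) y z c
      rw [AffineMap.lineMap_apply_module] at this
      obtain rfl : b = 1 - c := by linarith
      exact this
    have hx' := ((mem_uncut_iff hf).1 hx).2
    have key : ∀ i, f i (b • y + c • z) ≠ 0 ∧ (0 < f i (b • y + c • z) ↔ 0 < f i x) := by
      intro i
      have hyi := hyx i (Finset.mem_univ i)
      have hzi := hzx i (Finset.mem_univ i)
      rw [hval]
      rcases lt_or_gt_of_ne (hx' i (Finset.mem_univ i)) with h0 | h0
      · have h1 : f i y < 0 := lt_of_le_of_ne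
          (not_lt.1 fun h => by have := hyi.1 h; linarith) (hy.2 i (Finset.mem_univ i))
        have h2 : f i z < 0 := lt_of_le_of_ne
          (not_lt.1 fun h => by have := hzi.1 h; linarith) (hz.2 i (Finset.mem_univ i))
        have : b * f i y + c * f i z < 0 := by
          have := mul_neg_of_pos_of_neg hb h1
          have := mul_neg_of_pos_of_neg hc h2
          linarith
        exact ⟨this.ne, by constructor <;> intro <;> linarith⟩
      · have : 0 < b * f i y + c * f i z := by
          have := mul_pos hb (hyi.2 h0)
          have := mul_pos hc (hzi.2 h0)
          linarith
        exact ⟨this.ne', by constructor <;> intro <;> assumption⟩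
    exact ⟨(mem_uncut_iff hf).2 ⟨hK hy.1 hz.1 hb.le hc.le hbc, fun i _ => (key i).1⟩,
      posSet_eq_iff.2 fun i _ => (key i).2⟩

/-- `K` may contain boundary points, but a small move towards an interior point enters the interior
without changing any sign. -/
theorem regions_interior (hK : Convex ℝ K) (hne : (interior K).Nonempty) (s : Finset (Fin a)) :
    regions f (interior K) s = regions f K s := by
  refine Set.Subset.antisymm (regions_mono interior_subset) ?_
  rintro P ⟨x, hx, h1, rfl⟩
  obtain ⟨y, hy⟩ := hne
  obtain ⟨t, ⟨ht, ht'⟩, ht0⟩ := (((eventually_posSet_lineMap (f := f) (s := s) y h1).filter_mono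
    nhdsWithin_le_nhds).and (Ioo_mem_nhdsGT (zero_lt_one' ℝ))).exists
  refine ⟨_, hK.openSegment_self_interior_subset_interior hx hy ?_, ht, ht'⟩
  rw [openSegment_eq_image_lineMap]
  exact ⟨t, ht0, rfl⟩

theorem pieces_eq_image (hK : Convex ℝ K) (hf : ∀ i x, x ∈ L i ↔ f i x = 0) :
    pieces K L = (fun P => {y ∈ uncut K L | posSet f Finset.univ y = P}) ''
      regions f K Finset.univ := by
  ext C
  constructor
  · rintro ⟨x, hx, rfl⟩
    exact ⟨_, ⟨x, ((mem_uncut_iff hf).1 hx).1, ((mem_uncut_iff hf).1 hx).2, rfl⟩,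
      (connectedComponentIn_uncut hK hf hx).symm⟩
  · rintro ⟨P, ⟨x, hx, h1, rfl⟩, rfl⟩
    have hx' := (mem_uncut_iff hf).2 ⟨hx, h1⟩
    exact ⟨x, hx', (connectedComponentIn_uncut hK hf hx').symm⟩

theorem numPieces_eq_ncard_regions (hK : Convex ℝ K) (hne : (interior K).Nonempty)
    (hf : ∀ i x, x ∈ L i ↔ f i x = 0) :
    numPieces K L = (regions f (interior K) Finset.univ).ncard := by
  rw [numPieces, pieces_eq_image hK hf, Set.InjOn.ncard_image, regions_interior hK hne]
  rintro P ⟨x, hx, h1, rfl⟩ Q - h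
  have hx' : x ∈ {y ∈ uncut K L | posSet f Finset.univ y = Q} := by
    refine (Set.ext_iff.1 h x).1 ?_
    exact ⟨(mem_uncut_iff hf).2 ⟨hx, h1⟩, rfl⟩
  exact hx'.2

theorem pieces_finite (hK : Convex ℝ K) (hL : ∀ i, IsCut K (L i)) : (pieces K L).Finite := by
  obtain ⟨f, -, hf⟩ := exists_functionals hL
  rw [pieces_eq_image hK hf]
  exact regions_finite.image _

/-- Pairs are grouped by their larger index, to match the sum in `ncard_regions_plane`. -/
theorem numIntersect_eq_sum (K : Set Plane) (L : Fin a → AffineSubspace ℝ Plane)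
    [∀ i, DecidablePred fun j =>
      (interior K ∩ ((L j : Set Plane) ∩ (L i : Set Plane))).Nonempty] :
    numIntersect K L = ∑ i, (Finset.univ.filter fun j => j < i ∧
      (interior K ∩ ((L j : Set Plane) ∩ (L i : Set Plane))).Nonempty).card := by
  rw [numIntersect, ← Finset.card_sigma, ← Set.ncard_coe_finset]
  refine Set.ncard_congr (fun q _ => ⟨q.2, q.1⟩) ?_ ?_ ?_
  · rintro ⟨i, j⟩ h
    simpa using h
  · rintro ⟨i, j⟩ ⟨k, l⟩ _ _ h
    simp only [Sigma.mk.injEq, heq_eq_eq] at h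
    rw [h.1, h.2]
  · rintro ⟨i, j⟩ h
    exact ⟨(j, i), by simpa using h, rfl⟩

theorem numPieces_eq (hK : Convex ℝ K) (hne : (interior K).Nonempty)
    (hL : ∀ i, IsCut K (L i)) (hgp : GeneralPosition K L) :
    numPieces K L = numIntersect K L + a + 1 := by
  classical
  obtain ⟨f, h0, hf⟩ := exists_functionals hL
  rw [numPieces_eq_ncard_regions hK hne hf, ncard_regions_plane (relOpenConvex_interior hK),
    numIntersect_eq_sum, Finset.card_univ, Fintype.card_fin]
  · congr 2
    refine Finset.sum_congr rfl fun i _ => congrArg Finset.card ?_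
    refine Finset.filter_congr fun j _ => and_congr_right fun _ => ?_
    have : interior K ∩ {x | f i x = 0} ∩ {x | f j x = 0} =
        interior K ∩ ((L j : Set Plane) ∩ (L i : Set Plane)) := by
      ext x
      simp only [Set.mem_inter_iff, Set.mem_ofPred_eq, SetLike.mem_coe, hf]
      tauto
    rw [this]
  · intro i _
    obtain ⟨x, hx, hxL⟩ := (hL i).2
    exact ⟨x, hx, (hf i x).1 hxL⟩
  · exact hne
  · exact fun i _ => exists_ne_zero_of_isOpen isOpen_interior hne (h0 i)
  · rintro i - j - hij x ⟨⟨-, hxi⟩, hxj⟩ y ⟨⟨-, hyi⟩, hyj⟩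
    exact line_inter_subsingleton (hL i).1 (hL j).1 (hgp.1.ne hij) ((hf i x).2 hxi)
      ((hf j x).2 hxj) ((hf i y).2 hyi) ((hf j y).2 hyj)
  · intro i _ j _ hij
    obtain ⟨x, hx, hxL⟩ := (hL i).2
    obtain ⟨y, hy, hyL, hyx⟩ := exists_ne_mem_line isOpen_interior (hL i).1 hx hxL
    by_contra! hc
    exact hyx (line_inter_subsingleton (hL i).1 (hL j).1 (hgp.1.ne hij) hyL
      ((hf j y).2 (hc y ⟨hy, (hf i y).1 hyL⟩)) hxL ((hf j x).2 (hc x ⟨hx, (hf i x).1 hxL⟩)))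
  · intro i _ j _ k _ hij hjk hik x hx hi hj hk
    exact hgp.2 i j k hij hjk hik x hx ⟨(hf i x).2 hi, (hf j x).2 hj, (hf k x).2 hk⟩

/-- Each new line carries at most one crossing per earlier line. Coinciding cuts fall under the
second alternative of `ncard_regions_plane_le`. -/
theorem numPieces_le (hK : Convex ℝ K) (hne : (interior K).Nonempty)
    (hL : ∀ i, IsCut K (L i)) : numPieces K L ≤ a.choose 2 + a + 1 := by
  obtain ⟨f, h0, hf⟩ := exists_functionals hL
  rw [numPieces_eq_ncard_regions hK hne hf]
  refine (ncard_regions_plane_le (relOpenConvex_interior hK) fun i _ j _ => ?_).trans ?_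
  · by_cases hij : L i = L j
    · refine Or.inr fun x hx => ?_
      rw [← hf j, ← hij, hf i]
      exact hx.2
    · left
      rintro x ⟨⟨-, hxi⟩, hxj⟩ y ⟨⟨-, hyi⟩, hyj⟩
      exact line_inter_subsingleton (hL i).1 (hL j).1 hij ((hf i x).2 hxi)
        ((hf j x).2 hxj) ((hf i y).2 hyi) ((hf j y).2 hyj)
  · simp

/-- Sending a crossing pair to its meeting point is well defined because distinct lines meet at most
once, and injective because no third cut passes through that point. -/
theorem encard_crossingPoints (hL : ∀ i, IsCut K (L i)) (hgp : GeneralPosition K L) :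
    (crossingPoints K L).encard = (numIntersect K L : ℕ∞) := by
  set Q : Set (Fin a × Fin a) := {q | q.1 < q.2 ∧
    (interior K ∩ ((L q.1 : Set Plane) ∩ (L q.2 : Set Plane))).Nonempty} with hQ
  have hfin : Q.Finite := Set.toFinite _
  have hnum : (numIntersect K L : ℕ∞) = Q.encard := hfin.cast_ncard_eq
  have hch : ∀ q : Fin a × Fin a, ∃ p : Plane, q ∈ Q → p ∈ interior K ∧ p ∈ L q.1 ∧ p ∈ L q.2 := by
    intro q
    by_cases hq : q ∈ Q
    · obtain ⟨p, hp⟩ := hq.2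
      exact ⟨p, fun _ => hp⟩
    · exact ⟨0, fun h => absurd h hq⟩
  choose p hp using hch
  have himg : crossingPoints K L = p '' Q := by
    ext x
    constructor
    · rintro ⟨hx, i, j, hij, hi, hj⟩
      wlog hlt : i < j generalizing i j
      · exact this j i hij.symm hj hi (lt_of_le_of_ne (not_lt.1 hlt) hij.symm)
      have hq : (i, j) ∈ Q := ⟨hlt, x, hx, hi, hj⟩
      exact ⟨(i, j), hq, line_inter_subsingleton (hL i).1 (hL j).1 (hgp.1.ne hij)
        (hp _ hq).2.1 (hp _ hq).2.2 hi hj⟩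
    · rintro ⟨q, hq, rfl⟩
      exact ⟨(hp q hq).1, q.1, q.2, hq.1.ne, (hp q hq).2⟩
  rw [himg, hnum]
  refine Set.InjOn.encard_image ?_
  rintro ⟨i, j⟩ hq ⟨k, l⟩ hq' h
  have h1 := hp _ hq
  have h2 := hp _ hq'
  rw [← h] at h2
  have hlt : i < j := hq.1
  have hlt' : k < l := hq'.1
  have mem2 : ∀ m, p (i, j) ∈ L m → m = i ∨ m = j := by
    intro m hm
    by_contra! hc
    exact hgp.2 i j m hlt.ne hc.2.symm hc.1.symm _ h1.1 ⟨h1.2.1, h1.2.2, hm⟩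
  rcases mem2 k h2.2.1 with rfl | rfl <;> rcases mem2 l h2.2.2 with rfl | rfl
  · exact absurd hlt' (lt_irrefl _)
  · rfl
  · exact absurd hlt' hlt.asymm
  · exact absurd hlt' (lt_irrefl _)

end Pieces

/-! ### Coordinates for lines, and an optimal arrangement -/

/-- Twice the signed area of the triangle `p q x`. -/
def orient (p q x : Plane) : ℝ := (q 0 - p 0) * (x 1 - p 1) - (q 1 - p 1) * (x 0 - p 0)

theorem mem_line_iff_orient {p q : Plane} (hpq : p ≠ q) {x : Plane} :
    x ∈ line[ℝ, p, q] ↔ orient p q x = 0 := by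
  rw [mem_affineSpan_pair_iff_exists_lineMap_eq]
  constructor
  · rintro ⟨r, rfl⟩
    simp only [orient, AffineMap.lineMap_apply_module, PiLp.add_apply, PiLp.smul_apply, smul_eq_mul]
    ring
  · intro h
    simp only [orient] at h
    have hn : (q 0 - p 0) ^ 2 + (q 1 - p 1) ^ 2 ≠ 0 := by
      intro h0
      apply hpq
      have h1 : q 0 - p 0 = 0 := by nlinarith [sq_nonneg (q 0 - p 0), sq_nonneg (q 1 - p 1)]
      have h2 : q 1 - p 1 = 0 := by nlinarith [sq_nonneg (q 0 - p 0), sq_nonneg (q 1 - p 1)]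
      ext i
      fin_cases i
      · simp only [Fin.zero_eta]; linarith
      · simp only [Fin.mk_one]; linarith
    -- The parameter of the orthogonal projection of `x` to the line.
    refine ⟨((q 0 - p 0) * (x 0 - p 0) + (q 1 - p 1) * (x 1 - p 1)) /
      ((q 0 - p 0) ^ 2 + (q 1 - p 1) ^ 2), ?_⟩
    ext i
    fin_cases i
    · simp only [Fin.zero_eta, AffineMap.lineMap_apply_module, PiLp.add_apply, PiLp.smul_apply,
        smul_eq_mul]
      field_simp
      linear_combination (q 1 - p 1) * h
    · simp only [Fin.mk_one, AffineMap.lineMap_apply_module, PiLp.add_apply, PiLp.smul_apply,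
        smul_eq_mul]
      field_simp
      linear_combination -(q 0 - p 0) * h

theorem finrank_direction_line {p q : Plane} (hpq : p ≠ q) :
    Module.finrank ℝ (line[ℝ, p, q]).direction = 1 := by
  rw [direction_affineSpan, vectorSpan_pair_rev]
  exact finrank_span_singleton (vsub_ne_zero.2 hpq.symm)

theorem sum_card_filter_lt (a : ℕ) :
    ∑ i : Fin a, (Finset.univ.filter fun j => j < i).card = a.choose 2 := by
  have h : ∀ i : Fin a, (Finset.univ.filter fun j => j < i).card = (i : ℕ) := fun i => by
    rw [Finset.filter_gt_eq_Iio, Fin.card_Iio]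
  rw [Finset.sum_congr rfl fun i _ => h i, Fin.sum_univ_eq_sum_range (fun i => i) a,
    Finset.sum_range_id, Nat.choose_two_right]

/-- With `c` as origin, the lines `y = σ x - σ ^ 2` are tangents of the parabola `y = x ^ 2 / 4`.
Those of slopes `σ i` and `σ j` meet at `(σ i + σ j, σ i * σ j)`, whose abscissa prevents a third
from passing through. Small slopes bring all these points close to `c`. -/
theorem exists_generalPosition {K : Set Plane} (hne : (interior K).Nonempty) (a : ℕ) :
    ∃ L : Fin a → AffineSubspace ℝ Plane, (∀ i, IsCut K (L i)) ∧ GeneralPosition K L ∧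
      numIntersect K L = a.choose 2 := by
  obtain ⟨c, hc⟩ := hne
  have hev : ∀ᶠ e : ℝ in 𝓝 (0 : ℝ), ∀ i j : Fin a,
      c + !₂[e * (i : ℝ) + e * (j : ℝ), (e * (i : ℝ)) * (e * (j : ℝ))] ∈ interior K := by
    rw [Filter.eventually_all]
    intro i
    rw [Filter.eventually_all]
    intro j
    have hcont : Continuous fun e : ℝ => c + !₂[e * (i : ℝ) + e * (j : ℝ), (e * (i : ℝ)) * (e * (j : ℝ))] := by
      fun_prop
    refine hcont.tendsto' 0 c ?_ (isOpen_interior.mem_nhds hc)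
    ext k
    fin_cases k <;> simp
  obtain ⟨e, he, he0⟩ := ((hev.filter_mono nhdsWithin_le_nhds).and
    (self_mem_nhdsWithin : Set.Ioi (0 : ℝ) ∈ 𝓝[>] 0)).exists
  have he0 : 0 < e := he0
  set σ : Fin a → ℝ := fun i => e * (i : ℝ) with hσ
  have hσinj : Function.Injective σ := fun i j h =>
    Fin.ext (by exact_mod_cast mul_left_cancel₀ he0.ne' h)
  have hpq : ∀ s : ℝ, c + !₂[0, -s ^ 2] ≠ c + !₂[1, s - s ^ 2] := by
    intro s h
    have := congrArg (fun x : Plane => x 0) h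
    simp at this
  set L : Fin a → AffineSubspace ℝ Plane := fun i =>
    line[ℝ, c + !₂[0, -σ i ^ 2], c + !₂[1, σ i - σ i ^ 2]] with hLdef
  have hmem : ∀ i x, x ∈ L i ↔ x 1 - c 1 = σ i * (x 0 - c 0) - σ i ^ 2 := by
    intro i x
    rw [hLdef, mem_line_iff_orient (hpq _)]
    simp only [orient, PiLp.add_apply, Matrix.cons_val_zero, Matrix.cons_val_one]
    constructor <;> intro h <;> linear_combination h
  have hX : ∀ i j, c + !₂[σ i + σ j, σ i * σ j] ∈ L i ∧ c + !₂[σ i + σ j, σ i * σ j] ∈ L j := by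
    intro i j
    rw [hmem, hmem]
    simp only [PiLp.add_apply, Matrix.cons_val_zero, Matrix.cons_val_one]
    constructor <;> ring
  have hmeet : ∀ i j x, i ≠ j → x ∈ L i → x ∈ L j → x 0 - c 0 = σ i + σ j := by
    intro i j x hij hi hj
    rw [hmem] at hi hj
    have : σ i - σ j ≠ 0 := sub_ne_zero.2 (hσinj.ne hij)
    apply mul_left_cancel₀ this
    linear_combination hj - hi
  -- The case `i = j` of the meeting points is the point of tangency, which shows that each line
  -- enters the interior.
  refine ⟨L, fun i => ⟨finrank_direction_line (hpq _), _, he i i, (hX i i).1⟩, ⟨?_, ?_⟩, ?_⟩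
  · intro i j h
    by_contra hij
    have h1 := hmeet i j _ hij (hX i i).1 (h ▸ (hX i i).1)
    simp only [PiLp.add_apply, Matrix.cons_val_zero] at h1
    exact hij (hσinj (by linarith))
  · rintro i j k hij hjk hik p - ⟨hi, hj, hk⟩
    have h1 := hmeet i j p hij hi hj
    have h2 := hmeet i k p hik hi hk
    exact hjk (hσinj (by linarith))
  · classical
    rw [numIntersect_eq_sum, ← sum_card_filter_lt]
    refine Finset.sum_congr rfl fun i _ => congrArg Finset.card ?_
    refine Finset.filter_congr fun j _ => and_iff_left_of_imp fun _ => ?_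
    exact ⟨_, he j i, hX j i⟩

theorem isGreatest_pieceCounts {K : Set Plane} (hK : Convex ℝ K) (hne : (interior K).Nonempty)
    (a : ℕ) : IsGreatest (pieceCounts K a) (a.choose 2 + a + 1) := by
  obtain ⟨L, h1, h2, h3⟩ := exists_generalPosition hne a
  refine ⟨⟨L, h1, ?_⟩, ?_⟩
  · rw [numPieces_eq hK hne h1 h2, h3]
  · rintro n ⟨M, hM, rfl⟩
    exact numPieces_le hK hne hM

theorem maxPieces_eq {K : Set Plane} (hK : Convex ℝ K) (hne : (interior K).Nonempty) (a : ℕ) :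
    maxPieces K a = a.choose 2 + a + 1 :=
  (isGreatest_pieceCounts hK hne a).csSup_eq

theorem maxPieces_eq_real {K : Set Plane} (hK : Convex ℝ K) (hne : (interior K).Nonempty)
    (a : ℕ) : (maxPieces K a : ℝ) = (a : ℝ) ^ 2 / 2 + (a : ℝ) / 2 + 1 := by
  rw [maxPieces_eq hK hne]
  push_cast [Nat.cast_choose_two]
  ring

/-! ### Chords of the unit circle -/

@[simp] theorem circlePoint_zero (t : ℝ) : circlePoint t 0 = Real.cos t := rfl

@[simp] theorem circlePoint_one (t : ℝ) : circlePoint t 1 = Real.sin t := rfl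

theorem mem_interior_disc {x : Plane} : x ∈ interior disc ↔ x 0 ^ 2 + x 1 ^ 2 < 1 := by
  rw [disc, interior_closedBall _ one_ne_zero, mem_ball_zero_iff, EuclideanSpace.norm_eq,
    Fin.sum_univ_two, Real.sqrt_lt' one_pos]
  simp

theorem convex_disc : Convex ℝ disc := convex_closedBall _ _

theorem interior_disc_nonempty : (interior disc).Nonempty :=
  ⟨0, by rw [mem_interior_disc]; simp⟩

/-- For angles in `angles`, each half-angle sine has the sign of its difference of angles, so this
factorisation turns orientation into order. -/
theorem orient_circlePoint (s t u : ℝ) :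
    orient (circlePoint s) (circlePoint t) (circlePoint u) =
      4 * Real.sin ((t - s) / 2) * Real.sin ((u - s) / 2) * Real.sin ((u - t) / 2) := by
  simp only [orient, circlePoint_zero, circlePoint_one]
  rw [Real.cos_sub_cos, Real.sin_sub_sin, Real.sin_sub_sin, Real.cos_sub_cos,
    show (u - t) / 2 = (u + s) / 2 - (t + s) / 2 by ring, Real.sin_sub]
  ring

theorem circlePoint_sq_dist (s t : ℝ) :
    (Real.cos t - Real.cos s) ^ 2 + (Real.sin t - Real.sin s) ^ 2 =
      4 * Real.sin ((t - s) / 2) ^ 2 := by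
  rw [Real.cos_sub_cos, Real.sin_sub_sin]
  linear_combination 4 * Real.sin ((t - s) / 2) ^ 2 * Real.sin_sq_add_cos_sq ((t + s) / 2)

theorem exists_sin_half_eq_mul {x : ℝ} (h1 : -(2 * Real.pi) < x) (h2 : x < 2 * Real.pi) :
    ∃ k > 0, Real.sin (x / 2) = k * x := by
  rcases lt_trichotomy x 0 with h | h | h
  · refine ⟨Real.sin (x / 2) / x, div_pos_of_neg_of_neg ?_ h, (div_mul_cancel₀ _ h.ne).symm⟩
    exact Real.sin_neg_of_neg_of_neg_pi_lt (by linarith) (by linarith)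
  · exact ⟨1, one_pos, by simp [h]⟩
  · refine ⟨Real.sin (x / 2) / x, div_pos ?_ h, (div_mul_cancel₀ _ h.ne').symm⟩
    exact Real.sin_pos_of_pos_of_lt_pi (by linarith) (by linarith)

/-- The angles at which points of the circle are drawn. -/
abbrev angles : Set ℝ := Set.Ioo 0 (2 * Real.pi)

theorem sin_half_sub {s t : ℝ} (hs : s ∈ angles) (ht : t ∈ angles) :
    ∃ k > 0, Real.sin ((t - s) / 2) = k * (t - s) :=
  exists_sin_half_eq_mul (by linarith [hs.2, ht.1]) (by linarith [hs.1, ht.2])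

theorem sin_half_sub_ne_zero {s t : ℝ} (hs : s ∈ angles) (ht : t ∈ angles) (hst : s ≠ t) :
    Real.sin ((t - s) / 2) ≠ 0 := by
  obtain ⟨k, hk, h⟩ := sin_half_sub hs ht
  rw [h]
  exact mul_ne_zero hk.ne' (sub_ne_zero.2 hst.symm)

theorem circlePoint_ne {s t : ℝ} (hs : s ∈ angles) (ht : t ∈ angles) (hst : s ≠ t) :
    circlePoint s ≠ circlePoint t := by
  intro h
  have h0 := congrArg (fun x : Plane => x 0) h
  have h1 := congrArg (fun x : Plane => x 1) h
  simp only [circlePoint_zero, circlePoint_one] at h0 h1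
  have := circlePoint_sq_dist s t
  rw [h0, h1] at this
  have := sq_pos_of_ne_zero (sin_half_sub_ne_zero hs ht hst)
  linarith

theorem orient_circlePoint_ne_zero {s t u : ℝ} (hs : s ∈ angles) (ht : t ∈ angles)
    (hu : u ∈ angles) (hst : s ≠ t) (hsu : s ≠ u) (htu : t ≠ u) :
    orient (circlePoint s) (circlePoint t) (circlePoint u) ≠ 0 := by
  rw [orient_circlePoint]
  have h1 := sin_half_sub_ne_zero hs ht hst
  have h2 := sin_half_sub_ne_zero hs hu hsu
  have h3 := sin_half_sub_ne_zero ht hu htu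
  positivity

/-- The points of a chord inside the disc are those strictly between its end points. -/
theorem lineMap_circlePoint_mem_interior_disc {s t : ℝ} (hs : s ∈ angles) (ht : t ∈ angles)
    (hst : s ≠ t) (r : ℝ) :
    AffineMap.lineMap (circlePoint s) (circlePoint t) r ∈ interior disc ↔ 0 < r ∧ r < 1 := by
  have hpos := sq_pos_of_ne_zero (sin_half_sub_ne_zero hs ht hst)
  -- The power of a point: one minus the squared norm is `r * (1 - r)` times the squared chord
  -- length.
  have key : ((1 - r) * Real.cos s + r * Real.cos t) ^ 2 +
      ((1 - r) * Real.sin s + r * Real.sin t) ^ 2 =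
      1 - r * (1 - r) * (4 * Real.sin ((t - s) / 2) ^ 2) := by
    rw [← circlePoint_sq_dist]
    linear_combination (1 - r) * Real.sin_sq_add_cos_sq s + r * Real.sin_sq_add_cos_sq t
  rw [mem_interior_disc]
  simp only [AffineMap.lineMap_apply_module, PiLp.add_apply, PiLp.smul_apply, smul_eq_mul,
    circlePoint_zero, circlePoint_one]
  rw [key, sub_lt_self_iff, mul_pos_iff_of_pos_right (by positivity)]
  constructor
  · intro h
    rcases mul_pos_iff.1 h with h | h
    · exact ⟨h.1, by linarith [h.2]⟩
    · linarith [h.1, h.2]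
  · rintro ⟨h1, h2⟩
    exact mul_pos h1 (by linarith)

theorem isCut_chord {s t : ℝ} (hs : s ∈ angles) (ht : t ∈ angles) (hst : s ≠ t) :
    IsCut disc (line[ℝ, circlePoint s, circlePoint t]) :=
  ⟨finrank_direction_line (circlePoint_ne hs ht hst), _,
    (lineMap_circlePoint_mem_interior_disc hs ht hst (1 / 2)).2 (by norm_num),
    AffineMap.lineMap_mem_affineSpan_pair _ _ _⟩

/-- Negative if and only if `{s, t}` and `{u, v}` are interlaced. -/
def interlace (s t u v : ℝ) : ℝ := (u - s) * (u - t) * ((v - s) * (v - t))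

theorem orient_lineMap (p q x y : Plane) (r : ℝ) :
    orient p q (AffineMap.lineMap x y r) = (1 - r) * orient p q x + r * orient p q y := by
  simp only [orient, AffineMap.lineMap_apply_module, PiLp.add_apply, PiLp.smul_apply, smul_eq_mul]
  ring

/-- The factor `sin ((t - s) / 2)` occurs squared, and the other four sines are positive multiples
of the factors of `interlace`. -/
theorem orient_mul_orient_neg_iff {s t u v : ℝ} (hs : s ∈ angles) (ht : t ∈ angles)
    (hu : u ∈ angles) (hv : v ∈ angles) (hst : s ≠ t) :
    orient (circlePoint s) (circlePoint t) (circlePoint u) *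
      orient (circlePoint s) (circlePoint t) (circlePoint v) < 0 ↔ interlace s t u v < 0 := by
  obtain ⟨k1, h1, e1⟩ := sin_half_sub hs hu
  obtain ⟨k2, h2, e2⟩ := sin_half_sub ht hu
  obtain ⟨k3, h3, e3⟩ := sin_half_sub hs hv
  obtain ⟨k4, h4, e4⟩ := sin_half_sub ht hv
  have hpos := sq_pos_of_ne_zero (sin_half_sub_ne_zero hs ht hst)
  rw [orient_circlePoint, orient_circlePoint, e1, e2, e3, e4]
  have : 4 * Real.sin ((t - s) / 2) * (k1 * (u - s)) * (k2 * (u - t)) *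
      (4 * Real.sin ((t - s) / 2) * (k3 * (v - s)) * (k4 * (v - t))) =
      (16 * Real.sin ((t - s) / 2) ^ 2 * (k1 * k2 * k3 * k4)) * interlace s t u v := by
    rw [interlace]; ring
  have hc : 0 < 16 * Real.sin ((t - s) / 2) ^ 2 * (k1 * k2 * k3 * k4) := by positivity
  rw [this]
  exact ⟨fun h => not_le.1 fun h' => absurd h (not_lt.2 (mul_nonneg hc.le h')),
    mul_neg_of_pos_of_neg hc⟩

/-- Two chords meet inside the disc if and only if their end points are interlaced. -/
theorem chords_meet_iff {s t u v : ℝ} (hs : s ∈ angles) (ht : t ∈ angles)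
    (hu : u ∈ angles) (hv : v ∈ angles) (hst : s ≠ t) (huv : u ≠ v) (hsu : s ≠ u) (htu : t ≠ u) :
    (interior disc ∩ ((line[ℝ, circlePoint s, circlePoint t] : Set Plane) ∩
      (line[ℝ, circlePoint u, circlePoint v] : Set Plane))).Nonempty ↔
      interlace s t u v < 0 := by
  rw [← orient_mul_orient_neg_iff hs ht hu hv hst]
  have hu0 := orient_circlePoint_ne_zero hs ht hu hst hsu htu
  set α := orient (circlePoint s) (circlePoint t) (circlePoint u)
  set β := orient (circlePoint s) (circlePoint t) (circlePoint v)
  constructor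
  · rintro ⟨x, hx, hx1, hx2⟩
    rw [SetLike.mem_coe, mem_line_iff_orient (circlePoint_ne hs ht hst)] at hx1
    obtain ⟨r, rfl⟩ := mem_affineSpan_pair_iff_exists_lineMap_eq.1 hx2
    rw [lineMap_circlePoint_mem_interior_disc hu hv huv] at hx
    rw [orient_lineMap] at hx1
    have h2 : r * (α * β) = -((1 - r) * α ^ 2) := by linear_combination α * hx1
    have h3 : 0 < (1 - r) * α ^ 2 := mul_pos (by linarith [hx.2]) (by positivity)
    by_contra! hc
    have := mul_nonneg hx.1.le hc
    linarith
  · intro h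
    have hd : α - β ≠ 0 := by
      intro h0
      rw [show β = α by linarith] at h
      nlinarith [sq_nonneg α]
    -- Along the second chord the orientation is affine, with values `α` and `β` at the ends; this
    -- is the parameter of its zero.
    refine ⟨AffineMap.lineMap (circlePoint u) (circlePoint v) (α / (α - β)), ?_, ?_, ?_⟩
    · rw [lineMap_circlePoint_mem_interior_disc hu hv huv]
      have hsq : 0 < (α - β) ^ 2 := by positivity
      have e1 : α / (α - β) = (α ^ 2 - α * β) / (α - β) ^ 2 := by field_simp
      have e2 : 1 - α / (α - β) = (β ^ 2 - α * β) / (α - β) ^ 2 := by field_simp; ring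
      refine ⟨?_, sub_pos.1 ?_⟩
      · rw [e1]; exact div_pos (by nlinarith [sq_nonneg α]) hsq
      · rw [e2]; exact div_pos (by nlinarith [sq_nonneg β]) hsq
    · rw [SetLike.mem_coe, mem_line_iff_orient (circlePoint_ne hs ht hst), orient_lineMap]
      change (1 - α / (α - β)) * α + α / (α - β) * β = 0
      field_simp
      ring
    · exact AffineMap.lineMap_mem_affineSpan_pair _ _ _

/-- The left side is `‖z‖ * cos (t - z.arg)` with `z = α + β i`, and a nonconstant cosine takes each
value countably often. -/
theorem countable_trig_eq {α β : ℝ} (h : α ≠ 0 ∨ β ≠ 0) (c : ℝ) :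
    {t : ℝ | α * Real.cos t + β * Real.sin t = c}.Countable := by
  set z : ℂ := ⟨α, β⟩
  have hz : ‖z‖ ≠ 0 := by
    rw [norm_ne_zero_iff]
    intro h0
    have h1 : α = 0 := congrArg Complex.re h0
    have h2 : β = 0 := congrArg Complex.im h0
    tauto
  have hα : ‖z‖ * Real.cos z.arg = α := Complex.norm_mul_cos_arg z
  have hβ : ‖z‖ * Real.sin z.arg = β := Complex.norm_mul_sin_arg z
  have heq : ∀ t, α * Real.cos t + β * Real.sin t = ‖z‖ * Real.cos (t - z.arg) := fun t => by
    rw [Real.cos_sub, ← hα, ← hβ]; ring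
  rcases Set.eq_empty_or_nonempty {t : ℝ | α * Real.cos t + β * Real.sin t = c} with h0 | ⟨t₀, ht₀⟩
  · rw [h0]; exact Set.countable_empty
  refine (Set.countable_iUnion fun k : ℤ => (Set.toFinite
    {2 * k * Real.pi + (t₀ - z.arg) + z.arg, 2 * k * Real.pi - (t₀ - z.arg) + z.arg}).countable).mono
    fun t ht => ?_
  simp only [Set.mem_ofPred_eq] at ht ht₀
  have hcos : Real.cos (t₀ - z.arg) = Real.cos (t - z.arg) := by
    apply mul_left_cancel₀ hz
    rw [← heq, ← heq, ht, ht₀]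
  obtain ⟨k, hk⟩ := Real.cos_eq_cos_iff.1 hcos
  rw [Set.mem_iUnion]
  refine ⟨k, ?_⟩
  rcases hk with hk | hk
  · left; linarith
  · right; rw [Set.mem_singleton_iff]; linarith

/-- Given a point `(x, y)` inside the circle and an end point of a chord, only countably many
angles for the other end point give a chord through `(x, y)`. -/
theorem countable_chord_through {x y : ℝ} (h : x ^ 2 + y ^ 2 < 1) (s : ℝ) :
    {t | (Real.cos t - Real.cos s) * (y - Real.sin s) -
      (Real.sin t - Real.sin s) * (x - Real.cos s) = 0}.Countable := by
  have hne : y - Real.sin s ≠ 0 ∨ -(x - Real.cos s) ≠ 0 := by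
    by_contra! hc
    rw [show x = Real.cos s by linarith, show y = Real.sin s by linarith,
      Real.cos_sq_add_sin_sq] at h
    exact lt_irrefl _ h
  refine (countable_trig_eq hne
    (Real.cos s * (y - Real.sin s) - Real.sin s * (x - Real.cos s))).mono fun t ht => ?_
  simp only [Set.mem_ofPred_eq] at ht ⊢
  linear_combination ht

/-- Cramer's parameter on the line `p q` of its intersection with the line `p' q'`. -/
noncomputable def meetParam (p q p' q' : Plane) : ℝ :=
  ((p' 0 - p 0) * (q' 1 - p' 1) - (p' 1 - p 1) * (q' 0 - p' 0)) /
    ((q 0 - p 0) * (q' 1 - p' 1) - (q 1 - p 1) * (q' 0 - p' 0))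

/-- The explicit formula makes the crossing point a measurable function of the angles. If the
determinant vanished, both `p` and `q` would lie on the second line. -/
theorem eq_lineMap_meetParam {p q p' q' x : Plane} (hpq : p ≠ q) (hpq' : p' ≠ q')
    (hne : line[ℝ, p, q] ≠ line[ℝ, p', q']) (hx : x ∈ line[ℝ, p, q])
    (hx' : x ∈ line[ℝ, p', q']) : x = AffineMap.lineMap p q (meetParam p q p' q') := by
  have hx2 := hx'
  rw [mem_line_iff_orient hpq'] at hx'
  obtain ⟨r, rfl⟩ := mem_affineSpan_pair_iff_exists_lineMap_eq.1 hx
  rw [orient_lineMap] at hx'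
  have hD : (q 0 - p 0) * (q' 1 - p' 1) - (q 1 - p 1) * (q' 0 - p' 0) ≠ 0 := by
    intro h0
    have hp : orient p' q' p = 0 := by
      simp only [orient] at hx' ⊢
      linear_combination hx' + r * h0
    have hq : orient p' q' q = 0 := by
      simp only [orient] at hp ⊢
      linear_combination hp - h0
    rw [← mem_line_iff_orient hpq'] at hp hq
    exact hpq (line_inter_subsingleton (finrank_direction_line hpq) (finrank_direction_line hpq')
      hne (left_mem_affineSpan_pair _ _ _) hp (right_mem_affineSpan_pair _ _ _) hq)
  congr 1
  rw [meetParam, eq_div_iff hD]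
  simp only [orient] at hx'
  linear_combination -hx'

/-! ### Random chords are almost surely in general position -/

instance : IsProbabilityMeasure uniformAngle := by
  refine ProbabilityTheory.cond_isProbabilityMeasure_of_finite ?_ ?_
  · rw [Real.volume_Ioo]
    simp [Real.pi_pos]
  · rw [Real.volume_Ioo]
    exact ENNReal.ofReal_ne_top

instance (a : ℕ) : IsProbabilityMeasure (angleLaw a) := by
  unfold angleLaw; infer_instance

theorem uniformAngle_countable {S : Set ℝ} (hS : S.Countable) : uniformAngle S = 0 :=
  ProbabilityTheory.cond_absolutelyContinuous (hS.measure_zero volume)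

theorem ae_mem_angles : ∀ᵐ t ∂uniformAngle, t ∈ angles :=
  ProbabilityTheory.ae_cond_mem measurableSet_Ioo

/-- The law of the pair of end-point angles of one random chord. -/
noncomputable abbrev chordLaw : Measure (Fin 2 → ℝ) := Measure.pi fun _ => uniformAngle

variable {a : ℕ}

theorem iIndepFun_chords :
    ProbabilityTheory.iIndepFun (fun (i : Fin a) (φ : Fin a → Fin 2 → ℝ) => φ i) (angleLaw a) :=
  ProbabilityTheory.iIndepFun_pi (X := fun _ => id) fun _ => aemeasurable_id

theorem measurePreserving_chord (i : Fin a) :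
    MeasurePreserving (fun φ : Fin a → Fin 2 → ℝ => φ i) (angleLaw a) chordLaw :=
  measurePreserving_eval (fun _ => chordLaw) i

theorem measurePreserving_chord_pair {i j : Fin a} (hij : i ≠ j) :
    MeasurePreserving (fun φ : Fin a → Fin 2 → ℝ => (φ i, φ j)) (angleLaw a)
      (chordLaw.prod chordLaw) := by
  refine ⟨by fun_prop, ?_⟩
  have h := (ProbabilityTheory.indepFun_iff_map_prod_eq_prod_map_map
    (measurable_pi_apply i).aemeasurable (measurable_pi_apply j).aemeasurable).1
    (iIndepFun_chords.indepFun hij)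
  rw [h, (measurePreserving_chord i).map_eq, (measurePreserving_chord j).map_eq]

theorem measurePreserving_chord_triple {i j k : Fin a} (hij : i ≠ j) (hik : i ≠ k) (hjk : j ≠ k) :
    MeasurePreserving (fun φ : Fin a → Fin 2 → ℝ => ((φ i, φ j), φ k)) (angleLaw a)
      ((chordLaw.prod chordLaw).prod chordLaw) := by
  refine ⟨by fun_prop, ?_⟩
  have h := (ProbabilityTheory.indepFun_iff_map_prod_eq_prod_map_map
    (by fun_prop) (measurable_pi_apply k).aemeasurable).1 (iIndepFun_chords.indepFun_prodMk (fun i => by fun_prop) i j k hik hjk)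
  rw [h, (measurePreserving_chord_pair hij).map_eq, (measurePreserving_chord k).map_eq]

theorem measurePreserving_endpoints :
    MeasurePreserving (fun x : Fin 2 → ℝ => (x 0, x 1)) chordLaw
      (uniformAngle.prod uniformAngle) :=
  measurePreserving_piFinTwo fun _ => uniformAngle

theorem ae_ne : ∀ᵐ p : ℝ × ℝ ∂(uniformAngle.prod uniformAngle), p.1 ≠ p.2 := by
  have hm : MeasurableSet {p : ℝ × ℝ | p.1 = p.2} := measurableSet_eq_fun (by fun_prop) (by fun_prop)
  change (uniformAngle.prod uniformAngle) {p : ℝ × ℝ | ¬ p.1 ≠ p.2} = 0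
  simp only [ne_eq, not_not]
  rw [Measure.measure_prod_null hm]
  refine ae_of_all _ fun x => uniformAngle_countable ?_
  refine (Set.countable_singleton x).mono fun y hy => ?_
  exact (Eq.symm hy : y = x)

/-- The two chords of `x` meet in a point of the open disc that lies on the chord `y`
(in coordinates). -/
def concurrent : Set (((Fin 2 → ℝ) × (Fin 2 → ℝ)) × (ℝ × ℝ)) :=
  {z | (AffineMap.lineMap (circlePoint (z.1.1 0)) (circlePoint (z.1.1 1))
      (meetParam (circlePoint (z.1.1 0)) (circlePoint (z.1.1 1)) (circlePoint (z.1.2 0))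
        (circlePoint (z.1.2 1))) : Plane) ∈ interior disc ∧
    orient (circlePoint z.2.1) (circlePoint z.2.2)
      (AffineMap.lineMap (circlePoint (z.1.1 0)) (circlePoint (z.1.1 1))
      (meetParam (circlePoint (z.1.1 0)) (circlePoint (z.1.1 1)) (circlePoint (z.1.2 0))
        (circlePoint (z.1.2 1)))) = 0}

theorem measurableSet_concurrent : MeasurableSet concurrent := by
  simp only [concurrent, mem_interior_disc, orient, meetParam, AffineMap.lineMap_apply_module,
    PiLp.add_apply, PiLp.smul_apply, smul_eq_mul, circlePoint_zero, circlePoint_one]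
  rw [Set.ofPred_and]
  refine (measurableSet_lt ?_ ?_).inter (measurableSet_eq_fun ?_ ?_) <;> fun_prop

theorem measure_concurrent :
    ((chordLaw.prod chordLaw).prod (uniformAngle.prod uniformAngle)) concurrent = 0 := by
  rw [Measure.measure_prod_null measurableSet_concurrent]
  refine ae_of_all _ fun x => ?_
  change (uniformAngle.prod uniformAngle) (Prod.mk x ⁻¹' concurrent) = 0
  rw [Measure.measure_prod_null (measurable_prodMk_left measurableSet_concurrent)]
  refine ae_of_all _ fun s => uniformAngle_countable ?_
  set m : Plane := AffineMap.lineMap (circlePoint (x.1 0)) (circlePoint (x.1 1))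
      (meetParam (circlePoint (x.1 0)) (circlePoint (x.1 1)) (circlePoint (x.2 0))
        (circlePoint (x.2 1))) with hm
  -- Interiority is essential: if `m` were the point at angle `s`, every `t` would qualify. A zero
  -- determinant gives the parameter `0`, hence an end point, which falls under the second case.
  by_cases h : m ∈ interior disc
  · exact (countable_chord_through (mem_interior_disc.1 h) s).mono fun t ht => ht.2
  · refine Set.countable_empty.mono fun t ht => h ht.1

/-- Angles for which the chords are cuts in general position. -/
structure Generic (φ : Fin a → Fin 2 → ℝ) : Prop where
  mem : ∀ i k, φ i k ∈ angles
  ne : ∀ i, φ i 0 ≠ φ i 1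
  ne_of_ne : ∀ i j, i ≠ j → ∀ k l, φ i k ≠ φ j l
  not_concurrent : ∀ i j k, i ≠ j → j ≠ k → i ≠ k →
    ((φ i, φ j), (φ k 0, φ k 1)) ∉ concurrent

theorem ae_generic : ∀ᵐ φ ∂(angleLaw a), Generic φ := by
  have h1 : ∀ᵐ φ ∂(angleLaw a), ∀ i k, φ i k ∈ angles := by
    rw [ae_all_iff]; intro i
    rw [ae_all_iff]; intro k
    exact ((measurePreserving_eval (fun _ : Fin 2 => uniformAngle) k).comp
      (measurePreserving_chord i)).quasiMeasurePreserving.ae ae_mem_angles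
  have h2 : ∀ᵐ φ ∂(angleLaw a), ∀ i, φ i 0 ≠ φ i 1 := by
    rw [ae_all_iff]; intro i
    exact (measurePreserving_endpoints.comp
      (measurePreserving_chord i)).quasiMeasurePreserving.ae ae_ne
  have h3 : ∀ᵐ φ ∂(angleLaw a), ∀ i j, i ≠ j → ∀ k l, φ i k ≠ φ j l := by
    rw [ae_all_iff]; intro i
    rw [ae_all_iff]; intro j
    by_cases hij : i = j
    · exact ae_of_all _ fun φ h => absurd hij h
    have : ∀ k l, ∀ᵐ φ ∂(angleLaw a), φ i k ≠ φ j l := fun k l =>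
      (((measurePreserving_eval (fun _ : Fin 2 => uniformAngle) k).prod
        (measurePreserving_eval (fun _ : Fin 2 => uniformAngle) l)).comp
        (measurePreserving_chord_pair hij)).quasiMeasurePreserving.ae ae_ne
    filter_upwards [ae_all_iff.2 fun k => ae_all_iff.2 (this k)] with φ h _ using h
  have h4 : ∀ᵐ φ ∂(angleLaw a), ∀ i j k, i ≠ j → j ≠ k → i ≠ k →
      ((φ i, φ j), (φ k 0, φ k 1)) ∉ concurrent := by
    rw [ae_all_iff]; intro i
    rw [ae_all_iff]; intro j
    rw [ae_all_iff]; intro k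
    by_cases h : i ≠ j ∧ j ≠ k ∧ i ≠ k
    · have := (((MeasurePreserving.id (chordLaw.prod chordLaw)).prod
        measurePreserving_endpoints).comp (measurePreserving_chord_triple h.1 h.2.2
          h.2.1)).quasiMeasurePreserving.ae (measure_eq_zero_iff_ae_notMem.1 measure_concurrent)
      filter_upwards [this] with φ hφ _ _ _ using hφ
    · exact ae_of_all _ fun φ h1 h2 h3 => absurd ⟨h1, h2, h3⟩ h
  filter_upwards [h1, h2, h3, h4] with φ h1 h2 h3 h4 using ⟨h1, h2, h3, h4⟩

theorem Generic.isCut {φ : Fin a → Fin 2 → ℝ} (h : Generic φ) (i : Fin a) :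
    IsCut disc (circleCuts φ i) :=
  isCut_chord (h.mem i 0) (h.mem i 1) (h.ne i)

/-- A line meets the circle at most twice, so no end of another chord lies on it. -/
theorem Generic.injective {φ : Fin a → Fin 2 → ℝ} (h : Generic φ) :
    Function.Injective (circleCuts φ) := by
  intro i j hij
  by_contra hne
  have hm : circlePoint (φ j 0) ∈ circleCuts φ i := by
    rw [hij]
    exact left_mem_affineSpan_pair _ _ _
  rw [circleCuts, mem_line_iff_orient (circlePoint_ne (h.mem i 0) (h.mem i 1) (h.ne i))] at hm
  exact orient_circlePoint_ne_zero (h.mem i 0) (h.mem i 1) (h.mem j 0) (h.ne i)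
    (h.ne_of_ne i j hne 0 0) (h.ne_of_ne i j hne 1 0) hm

theorem Generic.generalPosition {φ : Fin a → Fin 2 → ℝ} (h : Generic φ) :
    GeneralPosition disc (circleCuts φ) := by
  refine ⟨h.injective, ?_⟩
  rintro i j k hij hjk hik p hp ⟨hi, hj, hk⟩
  have hne : ∀ i, circlePoint (φ i 0) ≠ circlePoint (φ i 1) := fun i =>
    circlePoint_ne (h.mem i 0) (h.mem i 1) (h.ne i)
  have hp' := eq_lineMap_meetParam (hne i) (hne j) (h.injective.ne hij) hi hj
  rw [circleCuts, mem_line_iff_orient (hne k)] at hk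
  rw [hp'] at hp hk
  exact h.not_concurrent i j k hij hjk hik ⟨hp, hk⟩

/-! ### Exchangeable pairings and the probability 1/3 -/

/-- Rearrangement of four independent angles. -/
theorem measurePreserving_exchange {μ : Measure ℝ} [SFinite μ] :
    MeasurePreserving (fun z : (ℝ × ℝ) × (ℝ × ℝ) => ((z.1.1, z.2.1), (z.1.2, z.2.2)))
      ((μ.prod μ).prod (μ.prod μ)) ((μ.prod μ).prod (μ.prod μ)) := by
  have e1 := measurePreserving_prodAssoc μ μ (μ.prod μ)
  have e2 := (MeasurePreserving.id μ).prod ((measurePreserving_prodAssoc μ μ μ).symm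
    MeasurableEquiv.prodAssoc)
  have e3 := (MeasurePreserving.id μ).prod ((Measure.measurePreserving_swap
    (μ := μ) (ν := μ)).prod (MeasurePreserving.id μ))
  have e4 := (MeasurePreserving.id μ).prod (measurePreserving_prodAssoc μ μ μ)
  have e5 := (measurePreserving_prodAssoc μ μ (μ.prod μ)).symm MeasurableEquiv.prodAssoc
  exact e5.comp (e4.comp (e3.comp (e2.comp e1)))

theorem measurePreserving_exchange_swap {μ : Measure ℝ} [SFinite μ] :
    MeasurePreserving (fun z : (ℝ × ℝ) × (ℝ × ℝ) => ((z.1.1, z.2.2), (z.2.1, z.1.2)))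
      ((μ.prod μ).prod (μ.prod μ)) ((μ.prod μ).prod (μ.prod μ)) := by
  have e1 := (MeasurePreserving.id (μ.prod μ)).prod
    (Measure.measurePreserving_swap (μ := μ) (ν := μ))
  exact e1.comp (measurePreserving_exchange.comp e1)

/-- The pairs of chords with interlaced end points. -/
def interlaced : Set ((ℝ × ℝ) × (ℝ × ℝ)) := {z | interlace z.1.1 z.1.2 z.2.1 z.2.2 < 0}

theorem measurableSet_interlaced : MeasurableSet interlaced := by
  unfold interlaced interlace
  exact measurableSet_lt (by fun_prop) (by fun_prop)

section Pairings

/-- The three products attached to the ways to pair up four numbers have sum `0`,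
and the pairings are interlaced according to the signs of their pairwise products. -/
theorem interlace_eq (s t u v : ℝ) :
    interlace s t u v = -(((s - u) * (v - t)) * ((s - v) * (t - u))) ∧
    interlace s u t v = -(((s - t) * (u - v)) * ((s - v) * (t - u))) ∧
    interlace s v u t = -(((s - t) * (u - v)) * ((s - u) * (v - t))) ∧
    (s - t) * (u - v) + (s - u) * (v - t) + (s - v) * (t - u) = 0 := by
  unfold interlace
  refine ⟨?_, ?_, ?_, ?_⟩ <;> ring

/-- At least one of the three ways to pair up four different angles is interlaced. -/
theorem exists_interlace_neg {s t u v : ℝ} (hst : s ≠ t) (huv : u ≠ v) (hsu : s ≠ u)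
    (htv : t ≠ v) (hsv : s ≠ v) (htu : t ≠ u) :
    interlace s t u v < 0 ∨ interlace s u t v < 0 ∨ interlace s v u t < 0 := by
  obtain ⟨eA, eB, eC, -⟩ := interlace_eq s t u v
  rw [eA, eB, eC]
  have hA : (s - t) * (u - v) ≠ 0 := mul_ne_zero (sub_ne_zero.2 hst) (sub_ne_zero.2 huv)
  have hB : (s - u) * (v - t) ≠ 0 := mul_ne_zero (sub_ne_zero.2 hsu) (sub_ne_zero.2 htv.symm)
  have hC : (s - v) * (t - u) ≠ 0 := mul_ne_zero (sub_ne_zero.2 hsv) (sub_ne_zero.2 htu)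
  generalize (s - t) * (u - v) = A at *
  generalize (s - u) * (v - t) = B at *
  generalize (s - v) * (t - u) = C at *
  -- Otherwise `-(B * C)`, `-(A * C)` and `-(A * B)` are all nonnegative, but their product is `-(A
  -- * B * C) ^ 2 < 0`.
  by_contra! hc
  have h0 : 0 < (A * B * C) ^ 2 := by positivity
  have h1 := mul_nonneg (mul_nonneg hc.1 hc.2.1) hc.2.2
  nlinarith

/-- Two interlaced pairings would give the three products of `interlace_eq` a common strict sign,
although their sum is zero. -/
theorem not_interlace_neg (s t u v : ℝ) :
    ¬ (interlace s t u v < 0 ∧ interlace s u t v < 0) ∧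
    ¬ (interlace s t u v < 0 ∧ interlace s v u t < 0) ∧
    ¬ (interlace s u t v < 0 ∧ interlace s v u t < 0) := by
  obtain ⟨eA, eB, eC, hsum⟩ := interlace_eq s t u v
  rw [eA, eB, eC]
  generalize (s - t) * (u - v) = A at *
  generalize (s - u) * (v - t) = B at *
  generalize (s - v) * (t - u) = C at *
  obtain rfl : A = -B - C := by linarith
  refine ⟨?_, ?_, ?_⟩ <;> rintro ⟨h1, h2⟩
  · nlinarith [sq_nonneg C]
  · nlinarith [sq_nonneg B]
  · nlinarith [sq_nonneg (B + C)]

end Pairings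

/-- Two independent random chords meet inside the disc with probability `1 / 3`. -/
theorem measure_interlaced :
    ((uniformAngle.prod uniformAngle).prod (uniformAngle.prod uniformAngle)).real interlaced =
      1 / 3 := by
  set Λ := (uniformAngle.prod uniformAngle).prod (uniformAngle.prod uniformAngle) with hΛ
  have m1 : MeasurePreserving _ Λ Λ := measurePreserving_exchange (μ := uniformAngle)
  have m2 : MeasurePreserving _ Λ Λ := measurePreserving_exchange_swap (μ := uniformAngle)
  set T : (ℝ × ℝ) × (ℝ × ℝ) → (ℝ × ℝ) × (ℝ × ℝ) := fun z => ((z.1.1, z.2.1), (z.1.2, z.2.2))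
  set T' : (ℝ × ℝ) × (ℝ × ℝ) → (ℝ × ℝ) × (ℝ × ℝ) := fun z => ((z.1.1, z.2.2), (z.2.1, z.1.2))
  have hS := measurableSet_interlaced
  have hT : MeasurableSet (T ⁻¹' interlaced) := m1.measurable hS
  have hT' : MeasurableSet (T' ⁻¹' interlaced) := m2.measurable hS
  have e1 : Λ.real (T ⁻¹' interlaced) = Λ.real interlaced :=
    m1.measureReal_preimage hS.nullMeasurableSet
  have e2 : Λ.real (T' ⁻¹' interlaced) = Λ.real interlaced :=
    m2.measureReal_preimage hS.nullMeasurableSet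
  have d1 : Disjoint interlaced (T ⁻¹' interlaced) := Set.disjoint_left.2 fun z h h' =>
    (not_interlace_neg z.1.1 z.1.2 z.2.1 z.2.2).1 ⟨h, h'⟩
  have d2 : Disjoint (interlaced ∪ T ⁻¹' interlaced) (T' ⁻¹' interlaced) :=
    Set.disjoint_left.2 fun z h h' => by
      rcases h with h | h
      · exact (not_interlace_neg z.1.1 z.1.2 z.2.1 z.2.2).2.1 ⟨h, h'⟩
      · exact (not_interlace_neg z.1.1 z.1.2 z.2.1 z.2.2).2.2 ⟨h, h'⟩
  have n : ∀ᵐ z ∂Λ, z.1.1 ≠ z.1.2 ∧ z.2.1 ≠ z.2.2 := by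
    have n1 : ∀ᵐ z ∂Λ, z.1.1 ≠ z.1.2 := Measure.quasiMeasurePreserving_fst.ae ae_ne
    have n2 : ∀ᵐ z ∂Λ, z.2.1 ≠ z.2.2 := Measure.quasiMeasurePreserving_snd.ae ae_ne
    exact n1.and n2
  have huniv : Λ.real ((interlaced ∪ T ⁻¹' interlaced) ∪ T' ⁻¹' interlaced) = 1 := by
    have : Λ ((interlaced ∪ T ⁻¹' interlaced) ∪ T' ⁻¹' interlaced)ᶜ = 0 := by
      refine measure_eq_zero_iff_ae_notMem.2 ?_
      -- Pulling `n` back along `T` and `T'` supplies the remaining four of the six inequalities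
      -- between the angles.
      filter_upwards [n, m1.quasiMeasurePreserving.ae n, m2.quasiMeasurePreserving.ae n]
        with z h1 h2 h3 hz
      apply hz
      rcases exists_interlace_neg h1.1 h1.2 h2.1 h2.2 h3.1 h3.2.symm with h | h | h
      · exact Or.inl (Or.inl h)
      · exact Or.inl (Or.inr h)
      · exact Or.inr h
    rw [measureReal_congr (ae_eq_univ.2 this), probReal_univ]
  rw [measureReal_union d2 hT', measureReal_union d1 hT, e1, e2] at huniv
  linarith

/-! ### Expectations and the limiting ratio -/

/-- The angles for which the chords `i` and `j` have interlaced end points. -/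
def interlacedChords (i j : Fin a) : Set (Fin a → Fin 2 → ℝ) :=
  {φ | interlace (φ i 0) (φ i 1) (φ j 0) (φ j 1) < 0}

theorem measurableSet_interlacedChords (i j : Fin a) : MeasurableSet (interlacedChords i j) := by
  unfold interlacedChords interlace
  refine measurableSet_lt ?_ ?_ <;> fun_prop

theorem measure_interlacedChords {i j : Fin a} (hij : i ≠ j) :
    (angleLaw a).real (interlacedChords i j) = 1 / 3 := by
  rw [← measure_interlaced]
  exact ((measurePreserving_endpoints.prod measurePreserving_endpoints).comp
    (measurePreserving_chord_pair hij)).measureReal_preimage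
      measurableSet_interlaced.nullMeasurableSet

theorem Generic.numIntersect_eq {φ : Fin a → Fin 2 → ℝ} (h : Generic φ) :
    (numIntersect disc (circleCuts φ) : ℝ) =
      ∑ i, ∑ j with j < i, (interlacedChords j i).indicator 1 φ := by
  classical
  rw [numIntersect_eq_sum, Nat.cast_sum]
  refine Finset.sum_congr rfl fun i _ => ?_
  rw [← Finset.filter_filter, Finset.card_filter, Nat.cast_sum]
  refine Finset.sum_congr rfl fun j hj => ?_
  have hji : j ≠ i := (Finset.mem_filter.1 hj).2.ne
  have := chords_meet_iff (h.mem j 0) (h.mem j 1) (h.mem i 0) (h.mem i 1) (h.ne j) (h.ne i)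
    (h.ne_of_ne j i hji 0 0) (h.ne_of_ne j i hji 1 0)
  simp only [circleCuts, Set.indicator_apply, interlacedChords, Set.mem_ofPred_eq, Pi.one_apply,
    this]
  split_ifs <;> simp

/-- Agreement almost everywhere with a finite sum of indicators gives integrability without a
separate measurability proof for the count. -/
theorem ae_numIntersect_eq : (fun φ => (numIntersect disc (circleCuts φ) : ℝ)) =ᵐ[angleLaw a]
    fun φ => ∑ i, ∑ j with j < i, (interlacedChords j i).indicator 1 φ :=
  ae_generic.mono fun _ h => h.numIntersect_eq

theorem ae_numPieces_eq : (fun φ => (numPieces disc (circleCuts φ) : ℝ)) =ᵐ[angleLaw a]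
    fun φ => (numIntersect disc (circleCuts φ) : ℝ) + a + 1 :=
  ae_generic.mono fun _ h => by
    simp only
    rw [numPieces_eq convex_disc interior_disc_nonempty h.isCut h.generalPosition]
    push_cast; ring

theorem integrable_indicator_interlacedChords (i j : Fin a) :
    Integrable ((interlacedChords i j).indicator (1 : (Fin a → Fin 2 → ℝ) → ℝ)) (angleLaw a) :=
  (integrable_const (1 : ℝ)).indicator (measurableSet_interlacedChords i j)

theorem integrable_numIntersect (a : ℕ) :
    Integrable (fun φ => (numIntersect disc (circleCuts φ) : ℝ)) (angleLaw a) :=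
  (integrable_finsetSum _ fun _ _ => integrable_finsetSum _ fun _ _ =>
    integrable_indicator_interlacedChords _ _).congr ae_numIntersect_eq.symm

theorem integrable_numPieces (a : ℕ) :
    Integrable (fun φ => (numPieces disc (circleCuts φ) : ℝ)) (angleLaw a) :=
  (((integrable_numIntersect a).add (integrable_const _)).add (integrable_const _)).congr
    ae_numPieces_eq.symm

theorem expectedIntersect_eq (a : ℕ) : expectedIntersect a = (a : ℝ) * ((a : ℝ) - 1) / 6 := by
  rw [expectedIntersect, integral_congr_ae ae_numIntersect_eq, integral_finsetSum _ fun _ _ =>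
    integrable_finsetSum _ fun _ _ => integrable_indicator_interlacedChords _ _]
  have h : ∀ i : Fin a, ∫ φ, ∑ j with j < i, (interlacedChords j i).indicator 1 φ ∂(angleLaw a) =
      ((Finset.univ.filter fun j => j < i).card : ℝ) * (1 / 3) := by
    intro i
    rw [integral_finsetSum _ fun _ _ => integrable_indicator_interlacedChords _ _,
      ← nsmul_eq_mul]
    refine Finset.sum_eq_card_nsmul fun j hj => ?_
    rw [integral_indicator_one (measurableSet_interlacedChords j i),
      measure_interlacedChords (Finset.mem_filter.1 hj).2.ne]
  rw [Finset.sum_congr rfl fun i _ => h i, ← Finset.sum_mul, ← Nat.cast_sum, sum_card_filter_lt,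
    Nat.cast_choose_two]
  ring

theorem expectedPieces_eq_add (a : ℕ) : expectedPieces a = expectedIntersect a + (a : ℝ) + 1 := by
  have h1 := integrable_numIntersect a
  have h2 : Integrable (fun φ => (numIntersect disc (circleCuts φ) : ℝ) + (a : ℝ))
      (angleLaw a) := h1.add (integrable_const _)
  rw [expectedPieces, integral_congr_ae ae_numPieces_eq, integral_add h2 (integrable_const _),
    integral_add h1 (integrable_const _), expectedIntersect]
  simp

theorem expectedPieces_eq (a : ℕ) :
    expectedPieces a = (a : ℝ) ^ 2 / 6 + 5 * (a : ℝ) / 6 + 1 := by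
  rw [expectedPieces_eq_add, expectedIntersect_eq]
  ring

theorem tendsto_expectedPieces_div_maxPieces :
    Tendsto (fun a : ℕ => expectedPieces a / (maxPieces disc a : ℝ)) atTop (𝓝 (1 / 3)) := by
  have h1 : Tendsto (fun a : ℕ => ((a : ℝ))⁻¹) atTop (𝓝 0) := tendsto_inv_atTop_nhds_zero_nat
  -- Numerator and denominator divided by `a ^ 2`; the two quotients agree for `a > 0`.
  have h2 : Tendsto (fun a : ℕ => (1 / 6 + 5 / 6 * (a : ℝ)⁻¹ + (a : ℝ)⁻¹ ^ 2) /
      (1 / 2 + 1 / 2 * (a : ℝ)⁻¹ + (a : ℝ)⁻¹ ^ 2)) atTop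
      (𝓝 ((1 / 6 + 5 / 6 * 0 + 0 ^ 2) / (1 / 2 + 1 / 2 * 0 + 0 ^ 2))) :=
    ((tendsto_const_nhds.add (h1.const_mul _)).add (h1.pow 2)).div
      ((tendsto_const_nhds.add (h1.const_mul _)).add (h1.pow 2)) (by norm_num)
  rw [show (1 / 6 + 5 / 6 * 0 + 0 ^ 2) / (1 / 2 + 1 / 2 * 0 + 0 ^ 2) = (1 / 3 : ℝ) by norm_num]
    at h2
  refine h2.congr' ?_
  filter_upwards [eventually_gt_atTop 0] with a ha
  have : (0 : ℝ) < a := by exact_mod_cast ha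
  rw [expectedPieces_eq, maxPieces_eq_real convex_disc interior_disc_nonempty]
  field_simp

end CrossingCuts

theorem mainTheorem4 :
    -- the number of pieces for cuts in general position
    (∀ (K : Set CrossingCuts.Plane), Convex ℝ K → (interior K).Nonempty →
      ∀ (a : ℕ) (L : Fin a → AffineSubspace ℝ CrossingCuts.Plane),
        (∀ i, CrossingCuts.IsCut K (L i)) →
        (CrossingCuts.pieces K L).Finite ∧
        (CrossingCuts.GeneralPosition K L →
          (CrossingCuts.crossingPoints K L).encard = (CrossingCuts.numIntersect K L : ℕ∞) ∧
          CrossingCuts.numPieces K L = CrossingCuts.numIntersect K L + a + 1)) ∧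
    -- the maximum number of pieces, attained in general position
    (∀ (K : Set CrossingCuts.Plane), Convex ℝ K → (interior K).Nonempty → ∀ a : ℕ,
      IsGreatest (CrossingCuts.pieceCounts K a) (CrossingCuts.maxPieces K a) ∧
      CrossingCuts.maxPieces K a = a.choose 2 + a + 1 ∧
      (CrossingCuts.maxPieces K a : ℝ) = (a : ℝ) ^ 2 / 2 + (a : ℝ) / 2 + 1 ∧
      ∃ L : Fin a → AffineSubspace ℝ CrossingCuts.Plane,
        (∀ i, CrossingCuts.IsCut K (L i)) ∧ CrossingCuts.GeneralPosition K L ∧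
        CrossingCuts.numPieces K L = CrossingCuts.maxPieces K a) ∧
    -- the expected number of pieces for random unit-circle cuts
    (∀ a : ℕ,
      Integrable (fun φ => (CrossingCuts.numIntersect CrossingCuts.disc
        (CrossingCuts.circleCuts φ) : ℝ)) (CrossingCuts.angleLaw a) ∧
      Integrable (fun φ => (CrossingCuts.numPieces CrossingCuts.disc
        (CrossingCuts.circleCuts φ) : ℝ)) (CrossingCuts.angleLaw a) ∧
      CrossingCuts.expectedIntersect a = (a : ℝ) * ((a : ℝ) - 1) / 6 ∧
      CrossingCuts.expectedPieces a = CrossingCuts.expectedIntersect a + (a : ℝ) + 1 ∧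
      CrossingCuts.expectedPieces a = (a : ℝ) ^ 2 / 6 + 5 * (a : ℝ) / 6 + 1) ∧
    -- the ratio of the expected to the maximum number of pieces
    Tendsto (fun a : ℕ => CrossingCuts.expectedPieces a /
      (CrossingCuts.maxPieces CrossingCuts.disc a : ℝ)) atTop (𝓝 (1 / 3)) := by
  refine ⟨fun K hK hne a L hL => ⟨CrossingCuts.pieces_finite hK hL, fun hgp =>
      ⟨CrossingCuts.encard_crossingPoints hL hgp, CrossingCuts.numPieces_eq hK hne hL hgp⟩⟩,
    fun K hK hne a => ?_, fun a => ⟨CrossingCuts.integrable_numIntersect a,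
      CrossingCuts.integrable_numPieces a, CrossingCuts.expectedIntersect_eq a,
      CrossingCuts.expectedPieces_eq_add a, CrossingCuts.expectedPieces_eq a⟩,
    CrossingCuts.tendsto_expectedPieces_div_maxPieces⟩
  have hmax := CrossingCuts.maxPieces_eq hK hne a
  refine ⟨hmax ▸ CrossingCuts.isGreatest_pieceCounts hK hne a, hmax,
    CrossingCuts.maxPieces_eq_real hK hne a, ?_⟩
  obtain ⟨L, h1, h2, h3⟩ := CrossingCuts.exists_generalPosition hne a
  exact ⟨L, h1, h2, by rw [CrossingCuts.numPieces_eq hK hne h1 h2, h3, hmax]⟩
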